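/- All graphs are finite. A multigraph may have loops and parallel edges; a graph is simple. A subdivision of a multigraph $R$ is a graph obtained from $R$ by a sequence of zero or more operations, each replacing an edge with endpoints $u,v$ by a path $uwv$ through a new vertex $w$ (equivalently, by replacing the edges of $R$ by internally disjoint paths through new vertices, a loop being replaced by a cycle). A maximum $R$-subdivision in a graph $G$ is a subgraph $F$ of $G$ that is (isomorphic to) a subdivision of $R$ and has the largest number of vertices $|V(F)|$ among all such subgraphs. Theorem 1. Let $R$ be a connected multigraph with $m \geq 1$ edges and let $G$ be a graph with $n$ vertices. If every two maximum $R$-subdivisions in $G$ have a vertex in common, then there is a set $S \subseteq V(G)$ with $$|S| \leq 8\, m^{5/4} n^{3/4}$$ such that every maximum $R$-subdivision in $G$ contains a vertex of $S$. In other words, the minimum size $\tau_R(G)$ of a set of vertices meeting every maximum $R$-subdivision in $G$ satisfies $\tau_R(G) \leq 8\, m^{5/4} n^{3/4}$. -/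

import Mathlib

/-- A multigraph (loops and parallel edges allowed) is connected if it has a vertex and any two of
its vertices are joined by a walk. -/
def Graph.IsConnected {α β : Type*} (R : Graph α β) : Prop :=
  R.vertexSet.Nonempty ∧
    ∀ x ∈ R.vertexSet, ∀ y ∈ R.vertexSet, Relation.ReflTransGen R.Adj x y

/-- The list of interior vertices of a walk (first and last entry of the support removed). -/
def SimpleGraph.Walk.interior {V : Type*} {G : SimpleGraph V} {u v : V} (w : G.Walk u v) :
    List V :=
  w.support.tail.dropLast

/-- A presentation of the subgraph `F` of `G` as a subdivision of the multigraph `R`: the vertices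
of `R` are identified with distinct vertices of `F`, and each edge `e` of `R` is replaced by a path
(by a cycle, if `e` is a loop) between its ends, such that all the interior vertices of these paths
are new and pairwise distinct, and different edges are replaced by paths without common edges;
`F` consists exactly of these vertices and these paths. -/
structure SubdivisionModel {α β V : Type*} (R : Graph α β) {G : SimpleGraph V}
    (F : G.Subgraph) where
  /-- the vertex of `F` that a vertex of `R` is identified with -/
  branch : α → V
  /-- one end of each edge of `R` -/
  src : R.edgeSet → α
  /-- the other end of each edge of `R` -/
  tgt : R.edgeSet → α
  /-- the path that replaces an edge of `R` -/
  path : ∀ e : R.edgeSet, G.Walk (branch (src e)) (branch (tgt e))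
  branch_injOn : Set.InjOn branch R.vertexSet
  isLink : ∀ e : R.edgeSet, R.IsLink e (src e) (tgt e)
  not_nil : ∀ e, ¬ (path e).Nil
  isTrail : ∀ e, (path e).IsTrail
  interior_nodup : ∀ e, (path e).interior.Nodup
  interior_new : ∀ e, ∀ x ∈ R.vertexSet, branch x ∉ (path e).interior
  interior_disjoint : ∀ e e', e ≠ e' → List.Disjoint (path e).interior (path e').interior
  edges_disjoint : ∀ e e', e ≠ e' → List.Disjoint (path e).edges (path e').edges
  verts_eq : F.verts = branch '' R.vertexSet ∪ {v | ∃ e, v ∈ (path e).support}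
  edgeSet_eq : F.edgeSet = {d | ∃ e, d ∈ (path e).edges}

/-- The subgraph `F` of `G` is a subdivision of `R`. -/
def IsSubdivision {α β V : Type*} (R : Graph α β) {G : SimpleGraph V} (F : G.Subgraph) : Prop :=
  Nonempty (SubdivisionModel R F)

/-- `F` is a maximum `R`-subdivision in `G`: one with the largest number of vertices. -/
def IsMaxSubdivision {α β V : Type*} (R : Graph α β) {G : SimpleGraph V} (F : G.Subgraph) : Prop :=
  IsSubdivision R F ∧ ∀ F' : G.Subgraph, IsSubdivision R F' → F'.verts.ncard ≤ F.verts.ncard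

/-- `S` is an `R`-transversal of `G`: it meets every maximum `R`-subdivision of `G`. -/
def IsSubdivisionTransversal {α β V : Type*} (R : Graph α β) (G : SimpleGraph V)
    (S : Finset V) : Prop :=
  ∀ F : G.Subgraph, IsMaxSubdivision R F → ∃ v ∈ S, v ∈ F.verts

/-! Let `𝓕` be the family of vertex sets of maximum subdivisions. Its members are connected and meet
pairwise, and each is rigid: a union of `m` paths, none of which can be lengthened by a detour
outside the member (`SubdivisionModel.exists_detour`). Only these properties are used in
`IsConnectedIntersecting.exists_transversal`. Suppose that no set of fewer than `N` vertices meets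
all members. Call a set `k`-rich if deleting fewer than `k` vertices never cuts it off from all
surviving members. A set meeting every member is `N`-rich. So a member is `N`-rich, hence so is, up
to a factor `m`, one of its paths, and such a path can be closed to a `2d`-rich cycle
(`exists_isCyclicList`). A `2d`-rich cycle meets every member (`IsCyclicList.not_disjoint`):
otherwise two disjoint walks from the cycle to nearby vertices on a path of a missed member would
give a long detour. Hence it is even `N`-rich. But a shortest `2d`-rich cycle has no shortcuts
(`IsCyclicList.min_le_length`), while breadth-first search joins two of its opposite rich arcs by a
walk of fewer than about `n / d` edges (`exists_short_walk`). For `d` near `√(mn)` this is a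
contradiction. The resulting bound has order `m ^ (3/2) * n ^ (1/2)`, which is below the required
one whenever the latter is less than `n`. -/

namespace SimpleGraph

/-! ### Avoiding walks and Menger's theorem for two paths -/

variable {V : Type*}

/-- `u` and `v` are joined by a walk of `G` that avoids `T`. -/
def JoinedOff (G : SimpleGraph V) (T : Set V) (u v : V) : Prop :=
  ∃ w : G.Walk u v, ∀ x ∈ w.support, x ∉ T

namespace JoinedOff

variable {G : SimpleGraph V} {T T' : Set V} {u v w : V}

theorem refl (h : u ∉ T) : G.JoinedOff T u u := ⟨.nil, by simpa using h⟩

theorem symm (h : G.JoinedOff T u v) : G.JoinedOff T v u := by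
  obtain ⟨p, hp⟩ := h
  exact ⟨p.reverse, by simpa using hp⟩

theorem trans (h : G.JoinedOff T u v) (h' : G.JoinedOff T v w) : G.JoinedOff T u w := by
  obtain ⟨p, hp⟩ := h
  obtain ⟨q, hq⟩ := h'
  refine ⟨p.append q, fun x hx => ?_⟩
  rcases (p.mem_support_append_iff q).1 hx with h | h
  exacts [hp x h, hq x h]

theorem cons (h : G.Adj u v) (hu : u ∉ T) (h' : G.JoinedOff T v w) : G.JoinedOff T u w := by
  obtain ⟨q, hq⟩ := h'
  refine ⟨.cons h q, fun x hx => ?_⟩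
  rw [Walk.support_cons, List.mem_cons] at hx
  rcases hx with rfl | h
  exacts [hu, hq x h]

theorem mono (hT : T' ⊆ T) (h : G.JoinedOff T u v) : G.JoinedOff T' u v := by
  obtain ⟨p, hp⟩ := h
  exact ⟨p, fun x hx hxT => hp x hx (hT hxT)⟩

theorem left_notMem (h : G.JoinedOff T u v) : u ∉ T := by
  obtain ⟨p, hp⟩ := h
  exact hp u p.start_mem_support

theorem right_notMem (h : G.JoinedOff T u v) : v ∉ T := h.symm.left_notMem

end JoinedOff

/-- The case of two paths of Menger's theorem, for two sets of vertices. -/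
theorem exists_disjoint_walks [Finite V] [Nonempty V] (G : SimpleGraph V) (A B : Set V)
    (h : ∀ t, ∃ a ∈ A, ∃ b ∈ B, G.JoinedOff {t} a b) :
    ∃ a ∈ A, ∃ b ∈ B, ∃ a' ∈ A, ∃ b' ∈ B, ∃ (p : G.Walk a b) (q : G.Walk a' b'),
      p.support.Disjoint q.support := by
  classical
  induction hk : G.edgeSet.ncard using Nat.strong_induction_on generalizing G A B with
  | _ k ih =>
  subst hk
  by_cases hG : ∃ x y, G.Adj x y
  swap
  · have key : ∀ t, ∃ a ∈ A, a ∈ B ∧ a ≠ t := by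
      intro t
      obtain ⟨a, ha, b, hb, w, hw⟩ := h t
      cases w with
      | nil => exact ⟨a, ha, hb, by simpa using hw⟩
      | cons h _ => exact absurd ⟨_, _, h⟩ hG
    obtain ⟨a, ha, hb, -⟩ := key (Classical.arbitrary V)
    obtain ⟨a', ha', hb', hne⟩ := key a
    refine ⟨a, ha, a, hb, a', ha', a', hb', .nil, .nil, ?_⟩
    simpa [List.disjoint_left] using hne
  obtain ⟨x₀, y₀, hxy₀⟩ := hG
  set G' := G.deleteEdges {s(x₀, y₀)} with hG'
  have hle : G' ≤ G := deleteEdges_le _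
  have hlt : G'.edgeSet.ncard < G.edgeSet.ncard := by
    apply Set.ncard_lt_ncard _ (Set.toFinite _)
    refine ⟨edgeSet_mono hle, fun hsub => ?_⟩
    have := hsub (show s(x₀, y₀) ∈ G.edgeSet from hxy₀)
    simp [hG'] at this
  have hadj : ∀ u v, G.Adj u v → s(u, v) ≠ s(x₀, y₀) → G'.Adj u v := by
    intro u v huv hne
    rw [hG', deleteEdges_adj]
    exact ⟨huv, hne⟩
  by_cases h' : ∀ t, ∃ a ∈ A, ∃ b ∈ B, G'.JoinedOff {t} a b
  · obtain ⟨a, ha, b, hb, a', ha', b', hb', p, q, hpq⟩ := ih _ hlt G' A B h' rfl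
    exact ⟨a, ha, b, hb, a', ha', b', hb', p.mapLe hle, q.mapLe hle, by simpa using hpq⟩
  push Not at h'
  obtain ⟨s, hs⟩ := h'
  -- In `G'` the vertex `s` separates `A` from `B`, so the deleted edge `xy` leaves the `A`-side
  -- `X`. Induction in `G'` links `A` to `{s, x}` and `{s, y}` to `B`; the pieces are glued at `s`
  -- and along `xy`.
  set X : Set V := {v | ∃ a ∈ A, G'.JoinedOff {s} a v} with hX
  have hsX : s ∉ X := fun ⟨a, _, hj⟩ => hj.right_notMem rfl
  have hAX : ∀ a ∈ A, a ≠ s → a ∈ X := fun a ha has => ⟨a, ha, .refl has⟩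
  have hBX : ∀ b ∈ B, b ∉ X := fun b hb ⟨a, ha, hj⟩ => hs a ha b hb hj
  have hstep : ∀ u ∈ X, ∀ v, G'.Adj u v → v ≠ s → v ∈ X := by
    rintro u ⟨a, ha, hj⟩ v huv hv
    exact ⟨a, ha, hj.trans (.cons huv hj.right_notMem (.refl hv))⟩
  obtain ⟨x, y, hxX, hyX, hys, hxy, hxyeq⟩ :
      ∃ x y, x ∈ X ∧ y ∉ X ∧ y ≠ s ∧ G.Adj x y ∧ s(x, y) = s(x₀, y₀) := by
    obtain ⟨a, ha, b, hb, w, hw⟩ := h s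
    obtain ⟨d, hd, hdX, hdX'⟩ := w.exists_boundary_dart X
      (hAX a ha (hw a w.start_mem_support)) (hBX b hb)
    have hds : d.snd ≠ s := hw _ (w.dart_snd_mem_support_of_mem_darts hd)
    refine ⟨d.fst, d.snd, hdX, hdX', hds, d.adj, ?_⟩
    by_contra hne
    exact hdX' (hstep _ hdX _ (hadj _ _ d.adj hne) hds)
  rw [← hxyeq] at hadj
  have hxs : x ≠ s := fun h => hsX (h ▸ hxX)
  have hadj' : ∀ u v, G.Adj u v → u ≠ x → v ≠ x → G'.Adj u v := by
    intro u v huv hu hv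
    refine hadj u v huv ?_
    simp only [ne_eq, Sym2.eq_iff]
    tauto
  have hadj'' : ∀ u v, G.Adj u v → u ≠ y → v ≠ y → G'.Adj u v := by
    intro u v huv hu hv
    refine hadj u v huv ?_
    simp only [ne_eq, Sym2.eq_iff]
    tauto
  have hcross : ∀ u ∈ X, ∀ v, G.Adj u v → v ∉ X → v = s ∨ (u = x ∧ v = y) := by
    intro u hu v huv hv
    by_contra hcon
    push Not at hcon
    refine hv (hstep u hu v (hadj u v huv ?_) hcon.1)
    simp only [ne_eq, Sym2.eq_iff]
    rintro (h | h)
    · exact hcon.2 h.1 h.2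
    · exact hyX (h.1 ▸ hu)
  have hA : ∀ t, ∃ a ∈ A, ∃ b ∈ ({s, x} : Set V), G'.JoinedOff {t} a b := by
    intro t
    -- A walk can leave `X` only into `s` or from `x`; up to its first visit to `s` or `x` it does
    -- not use `xy`.
    have claim : ∀ u v (w : G.Walk u v), v ∉ X → (∀ z ∈ w.support, z ≠ t) → (u ∈ X ∨ u = s) →
        ∃ b ∈ ({s, x} : Set V), G'.JoinedOff {t} u b := by
      intro u v w
      induction w with
      | nil =>
        intro hv hw hu
        refine ⟨s, by simp, ?_⟩
        rw [hu.resolve_left hv] at hw ⊢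
        exact .refl (by simpa using hw)
      | @cons u u' v huu p ihp =>
        intro hv hw hu
        have hut : u ∉ ({t} : Set V) := hw u (by simp)
        rcases hu with hu | rfl
        swap
        · exact ⟨u, by simp, .refl hut⟩
        by_cases hux : u = x
        · exact ⟨x, by simp, by rw [← hux]; exact .refl hut⟩
        have hpw : ∀ z ∈ p.support, z ≠ t := fun z hz => hw z (by simp [hz])
        have huy : u ≠ y := fun h => hyX (h ▸ hu)
        by_cases hu' : u' ∈ X
        · obtain ⟨b, hb, hj⟩ := ihp hv hpw (.inl hu')
          exact ⟨b, hb, .cons (hadj'' _ _ huu huy (fun h => hyX (h ▸ hu'))) hut hj⟩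
        · rcases hcross u hu u' huu hu' with rfl | h
          · exact ⟨u', by simp, .cons (hadj'' _ _ huu huy hys.symm) hut
              (.refl (hpw _ p.start_mem_support))⟩
          · exact absurd h.1 hux
    obtain ⟨a, ha, b, hb, w, hw⟩ := h t
    obtain ⟨c, hc, hj⟩ := claim a b w (hBX b hb) hw (by
      by_cases has : a = s
      exacts [.inr has, .inl (hAX a ha has)])
    exact ⟨a, ha, c, hc, hj⟩
  have hB : ∀ t, ∃ a ∈ ({s, y} : Set V), ∃ b ∈ B, G'.JoinedOff {t} a b := by
    intro t
    -- Read backwards from its end, the walk stays outside `X` and does not use `xy` until it meets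
    -- `s`, or enters `X` through `y`.
    have claim : ∀ u v (w : G.Walk u v), v ∉ X → (∀ z ∈ w.support, z ≠ t) →
        (∃ c ∈ ({s, y} : Set V), G'.JoinedOff {t} c v) ∨
          (u ∉ X ∧ u ≠ s ∧ G'.JoinedOff {t} u v) := by
      intro u v w
      induction w with
      | @nil u =>
        intro hv hw
        have hut : u ∉ ({t} : Set V) := hw u (by simp)
        by_cases hus : u = s
        · exact .inl ⟨u, by simp [hus], .refl hut⟩
        · exact .inr ⟨hv, hus, .refl hut⟩
      | @cons u u' v huu p ihp =>
        intro hv hw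
        have hut : u ∉ ({t} : Set V) := hw u (by simp)
        rcases ihp hv (fun z hz => hw z (by simp [hz])) with hl | ⟨hu'X, hu's, hj⟩
        · exact .inl hl
        have hu'x : u' ≠ x := fun h => hu'X (h ▸ hxX)
        by_cases hus : u = s
        · exact .inl ⟨u, by simp [hus], .cons (hadj' _ _ huu (hus ▸ hxs.symm) hu'x) hut hj⟩
        by_cases huX : u ∈ X
        · rcases hcross u huX u' huu hu'X with h | h
          · exact absurd h hu's
          · exact .inl ⟨u', by simp [h.2], hj⟩
        · exact .inr ⟨huX, hus, .cons (hadj' _ _ huu (fun h => huX (h ▸ hxX)) hu'x) hut hj⟩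
    obtain ⟨a, ha, b, hb, w, hw⟩ := h t
    rcases claim a b w (hBX b hb) hw with ⟨c, hc, hj⟩ | ⟨haX, has, -⟩
    · exact ⟨c, hc, b, hb, hj⟩
    · exact absurd (hAX a ha has) haX
  obtain ⟨a, ha, a', ha', ps, px, hps, hpsx, hpx⟩ : ∃ a ∈ A, ∃ a' ∈ A, ∃ (p : G'.Walk a s)
      (q : G'.Walk a' x), p.IsPath ∧ p.support.Disjoint q.support ∧ ∀ v ∈ q.support, v ∈ X := by
    obtain ⟨a, ha, a', ha', p, q, hd⟩ : ∃ a ∈ A, ∃ a' ∈ A, ∃ (p : G'.Walk a s)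
        (q : G'.Walk a' x), p.support.Disjoint q.support := by
      obtain ⟨a, ha, b, hb, a', ha', b', hb', p, q, hd⟩ := ih _ hlt G' A {s, x} hA rfl
      have hbb : b ≠ b' := fun h => hd p.end_mem_support (h ▸ q.end_mem_support)
      rcases hb with rfl | rfl <;> rcases hb' with rfl | rfl
      · exact absurd rfl hbb
      · exact ⟨a, ha, a', ha', p, q, hd⟩
      · exact ⟨a', ha', a, ha, q, p, hd.symm⟩
      · exact absurd rfl hbb
    refine ⟨a, ha, a', ha', p.bypass, q, p.bypass_isPath,
      fun z hz hz' => hd (p.support_bypass_subset_support hz) hz', fun v hv => ⟨a', ha', ?_⟩⟩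
    refine ⟨q.takeUntil v hv, fun z hz hzs => ?_⟩
    rw [Set.mem_singleton_iff] at hzs
    exact hd p.end_mem_support (hzs ▸ q.support_takeUntil_subset_support hv hz)
  have hpsX : ∀ v ∈ ps.support, v ≠ s → v ∈ X := fun v hv hvs =>
    ⟨a, ha, ps.takeUntil v hv, fun z hz hzs =>
      ps.endpoint_notMem_support_takeUntil hps hv hvs.symm (hzs ▸ hz)⟩
  obtain ⟨b, hb, b', hb', qs, qy, hqs, hqsy, hqy⟩ : ∃ b ∈ B, ∃ b' ∈ B, ∃ (p : G'.Walk b s)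
      (q : G'.Walk b' y), p.IsPath ∧ p.support.Disjoint q.support ∧
        ∀ v ∈ q.support, G'.JoinedOff {s} b' v := by
    obtain ⟨b, hb, b', hb', p, q, hd⟩ : ∃ b ∈ B, ∃ b' ∈ B, ∃ (p : G'.Walk b s)
        (q : G'.Walk b' y), p.support.Disjoint q.support := by
      obtain ⟨a, ha, b, hb, a', ha', b', hb', p, q, hd⟩ := ih _ hlt G' {s, y} B hB rfl
      have haa : a ≠ a' := fun h => hd p.start_mem_support (h ▸ q.start_mem_support)
      rcases ha with rfl | rfl <;> rcases ha' with rfl | rfl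
      · exact absurd rfl haa
      · exact ⟨b, hb, b', hb', p.reverse, q.reverse, by simpa using hd⟩
      · exact ⟨b', hb', b, hb, q.reverse, p.reverse, by simpa using hd.symm⟩
      · exact absurd rfl haa
    refine ⟨b, hb, b', hb', p.bypass, q, p.bypass_isPath,
      fun z hz hz' => hd (p.support_bypass_subset_support hz) hz', fun v hv => ?_⟩
    refine ⟨q.takeUntil v hv, fun z hz hzs => ?_⟩
    rw [Set.mem_singleton_iff] at hzs
    exact hd p.end_mem_support (hzs ▸ q.support_takeUntil_subset_support hv hz)
  have hqyX : ∀ v ∈ qy.support, v ∉ X := fun v hv ⟨c, hc, hj⟩ =>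
    hs c hc b' hb' (hj.trans (hqy v hv).symm)
  have hqsX : ∀ v ∈ qs.support, v ∉ X := by
    rintro v hv ⟨c, hc, hj⟩
    have hvs : v ≠ s := hj.right_notMem
    refine hs c hc b hb (hj.trans (JoinedOff.symm ⟨qs.takeUntil v hv, fun z hz hzs => ?_⟩))
    exact qs.endpoint_notMem_support_takeUntil hqs hv hvs.symm (hzs ▸ hz)
  refine ⟨a, ha, b, hb, a', ha', b', hb', (ps.append qs.reverse).mapLe hle,
    (px.mapLe hle).append (.cons hxy (qy.reverse.mapLe hle)), ?_⟩
  -- The pieces from `A` lie in `X` apart from `s`; those from `B` avoid `X`.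
  intro z hz hz'
  simp only [Walk.mem_support_append_iff, Walk.support_mapLe_eq_support, Walk.support_reverse,
    List.mem_reverse, Walk.support_cons, List.mem_cons] at hz hz'
  have hz' : z ∈ px.support ∨ z ∈ qy.support := by
    rcases hz' with h | rfl | h
    exacts [.inl h, .inl px.end_mem_support, .inr h]
  rcases hz with hz | hz <;> rcases hz' with hz' | hz'
  · exact hpsx hz hz'
  · refine hqyX z hz' (hpsX z hz ?_)
    rintro rfl
    exact (hqy z hz').right_notMem rfl
  · exact hqsX z hz (hpx z hz')
  · exact hqsy hz hz'

/-- A shortest piece of a walk that leads from `A` to `B`. -/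
theorem Walk.exists_isPath_between {G : SimpleGraph V} {A B : Set V} {a b : V} (ha : a ∈ A)
    (hb : b ∈ B) (w : G.Walk a b) :
    ∃ x ∈ A, ∃ y ∈ B, ∃ q : G.Walk x y, q.IsPath ∧ q.support ⊆ w.support ∧
      (∀ z ∈ q.support, z ∈ A → z = x) ∧ ∀ z ∈ q.support, z ∈ B → z = y := by
  classical
  have hex : ∃ k, ∃ x ∈ A, ∃ y ∈ B, ∃ q : G.Walk x y, q.support ⊆ w.support ∧ q.length = k :=
    ⟨_, a, ha, b, hb, w, List.Subset.refl _, rfl⟩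
  obtain ⟨x, hx, y, hy, q, hq, hlen⟩ := Nat.find_spec hex
  have hmin : ∀ x' ∈ A, ∀ y' ∈ B, ∀ q' : G.Walk x' y', q'.support ⊆ w.support →
      q.length ≤ q'.length := by
    intro x' hx' y' hy' q' hq'
    rw [hlen]
    exact Nat.find_min' hex ⟨x', hx', y', hy', q', hq', rfl⟩
  have hsub := q.support_bypass_subset_support
  have hle := q.length_bypass_le_length
  refine ⟨x, hx, y, hy, q.bypass, q.bypass_isPath, fun _ hv => hq (hsub hv), fun z hz hzA => ?_,
    fun z hz hzB => ?_⟩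
  · by_contra hne
    have h1 := hmin z hzA y hy (q.bypass.dropUntil z hz)
      (fun _ hv => hq (hsub (q.bypass.support_dropUntil_subset_support hz hv)))
    have h2 := congrArg Walk.length (q.bypass.take_spec hz)
    rw [Walk.length_append] at h2
    have h3 : 0 < (q.bypass.takeUntil z hz).length := by
      rw [Nat.pos_iff_ne_zero]
      intro h0
      exact hne (Walk.eq_of_length_eq_zero h0).symm
    omega
  · by_contra hne
    have h1 := hmin x hx z hzB (q.bypass.takeUntil z hz)
      (fun _ hv => hq (hsub (q.bypass.support_takeUntil_subset_support hz hv)))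
    have h2 := q.bypass.length_takeUntil_lt_length hz hne
    omega

variable {G : SimpleGraph V}

/-- Two disjoint walks from `A` to `B` off `W`, if no single vertex separates `A` from `B` off
`W`. -/
theorem exists_disjoint_walks_off [Finite V] [Nonempty V] (A B W : Set V)
    (h : ∀ t, ∃ a ∈ A, ∃ b ∈ B, G.JoinedOff (W ∪ {t}) a b) :
    ∃ a ∈ A, ∃ b ∈ B, ∃ a' ∈ A, ∃ b' ∈ B, ∃ (p : G.Walk a b) (q : G.Walk a' b'),
      p.support.Disjoint q.support ∧ (∀ z ∈ p.support, z ∉ W) ∧ ∀ z ∈ q.support, z ∉ W := by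
  let H : SimpleGraph V :=
    { Adj := fun u v => G.Adj u v ∧ u ∉ W ∧ v ∉ W
      symm := ⟨fun u v h => ⟨h.1.symm, h.2.2, h.2.1⟩⟩
      loopless := ⟨fun u h => G.loopless.irrefl u h.1⟩ }
  have hle : H ≤ G := fun u v h => h.1
  have htrans : ∀ (t u v : V) (w : G.Walk u v), (∀ z ∈ w.support, z ∉ W ∪ {t}) →
      H.JoinedOff {t} u v := by
    intro t u v w
    induction w with
    | nil =>
      intro hw
      exact .refl fun h => hw _ (by simp) (.inr h)
    | @cons u u' v huu p ih =>
      intro hw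
      have hu := hw u (by simp)
      have hu' := hw u' (by simp)
      refine .cons (show H.Adj u u' from ⟨huu, fun h => hu (.inl h), fun h => hu' (.inl h)⟩)
        (fun h => hu (.inr h)) (ih fun z hz => hw z (by simp [hz]))
  have hoff : ∀ (u v : V) (w : H.Walk u v), u ∉ W → ∀ z ∈ w.support, z ∉ W := by
    intro u v w
    induction w with
    | nil => simp
    | cons huu p ih =>
      intro hu z hz
      rw [Walk.support_cons, List.mem_cons] at hz
      rcases hz with rfl | hz
      exacts [hu, ih huu.2.2 z hz]
  -- In `H` the vertices of `W` are isolated, not deleted; starting in `A \ W` rules out trivial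
  -- walks inside `W`.
  obtain ⟨a, ha, b, hb, a', ha', b', hb', p, q, hd⟩ := H.exists_disjoint_walks (A \ W) B (by
    intro t
    obtain ⟨a, ha, b, hb, w, hw⟩ := h t
    exact ⟨a, ⟨ha, fun h => hw a w.start_mem_support (.inl h)⟩, b, hb, htrans t a b w hw⟩)
  exact ⟨a, ha.1, b, hb, a', ha'.1, b', hb', p.mapLe hle, q.mapLe hle, by simpa using hd,
    by simpa using hoff _ _ p ha.2, by simpa using hoff _ _ q ha'.2⟩

/-! ### Cycles and their arcs -/

/-- The vertices of a cycle of `G`, listed in cyclic order (a single edge counts as a cycle of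
length two). -/
def IsCyclicList (G : SimpleGraph V) (c : List V) : Prop :=
  c.Nodup ∧ Cycle.Chain G.Adj (c : Cycle V)

theorem IsCyclicList.of_isRotated {c c' : List V} (h : G.IsCyclicList c) (hc : c ~r c') :
    G.IsCyclicList c' :=
  ⟨hc.nodup_iff.1 h.1, by rw [← Cycle.coe_eq_coe.2 hc]; exact h.2⟩

theorem isCyclicList_iff_arcs {x y : V} {l l' : List V} :
    G.IsCyclicList (x :: (l ++ y :: l')) ↔ (x :: (l ++ y :: l')).Nodup ∧
      (x :: (l ++ [y])).IsChain G.Adj ∧ (y :: (l' ++ [x])).IsChain G.Adj := by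
  rw [IsCyclicList, Cycle.chain_coe_cons,
    show x :: (l ++ y :: l' ++ [x]) = (x :: l) ++ y :: (l' ++ [x]) by simp, List.isChain_split]
  simp

theorem exists_walk_of_isChain {x y : V} {l : List V} (h : (x :: (l ++ [y])).IsChain G.Adj) :
    ∃ r : G.Walk x y, r.support = x :: (l ++ [y]) :=
  ⟨(Walk.ofSupport _ (by simp) h).copy (by simp) (by simp),
    (Walk.support_copy ..).trans (Walk.support_ofSupport _ h)⟩

theorem Walk.support_eq_interior {x y : V} (q : G.Walk x y) (h : ¬ q.Nil) :
    q.support = x :: (q.interior ++ [y]) := by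
  cases q with
  | nil => simp at h
  | cons h q => simp [interior]

theorem IsCyclicList.exists_isRotated {c : List V} {x y : V} (hx : x ∈ c)
    (hy : y ∈ c) (hxy : x ≠ y) : ∃ l l', c ~r x :: (l ++ y :: l') := by
  obtain ⟨s, t, rfl⟩ := List.append_of_mem hx
  have hy' : y ∈ t ++ s := by simp at hy ⊢; tauto
  obtain ⟨l, l', h⟩ := List.append_of_mem hy'
  refine ⟨l, l', ?_⟩
  rw [← h, ← List.cons_append]
  exact List.isRotated_append

/-- Two vertices of a cycle are joined by an arc that is at least half as long as the cycle. -/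
theorem IsCyclicList.exists_long_arc {c : List V} (h : G.IsCyclicList c) {x y : V} (hx : x ∈ c)
    (hy : y ∈ c) (hxy : x ≠ y) :
    ∃ r : G.Walk x y, r.IsPath ∧ (∀ z ∈ r.support, z ∈ c) ∧ c.length ≤ 2 * r.length := by
  obtain ⟨l, l', hc⟩ := exists_isRotated hx hy hxy
  obtain ⟨hnd, h1, h2⟩ := isCyclicList_iff_arcs.1 (h.of_isRotated hc)
  obtain ⟨r, hr⟩ := exists_walk_of_isChain h1
  obtain ⟨r', hr'⟩ := exists_walk_of_isChain h2
  have hlen := hc.perm.length_eq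
  have hmem := fun z => hc.mem_iff (a := z)
  have hrl := r.length_support
  have hrl' := r'.length_support
  rw [hr] at hrl
  rw [hr'] at hrl'
  simp only [List.length_cons, List.length_append, List.length_nil] at hlen hrl hrl'
  simp only [List.nodup_cons, List.nodup_append, List.mem_append, List.mem_cons] at hnd
  by_cases hll : l'.length ≤ l.length
  · refine ⟨r, ?_, ?_, by omega⟩
    · rw [Walk.isPath_def, hr]
      simp only [List.nodup_cons, List.nodup_append, List.mem_append, List.mem_cons]
      grind
    · intro z hz
      rw [hr] at hz
      rw [hmem]
      simp at hz ⊢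
      tauto
  · refine ⟨r'.reverse, ?_, ?_, by rw [Walk.length_reverse]; omega⟩
    · rw [Walk.isPath_reverse_iff, Walk.isPath_def, hr']
      simp only [List.nodup_cons, List.nodup_append, List.mem_append, List.mem_cons]
      grind
    · intro z hz
      rw [Walk.support_reverse, List.mem_reverse, hr'] at hz
      rw [hmem]
      simp at hz ⊢
      tauto

theorem IsCyclicList.isRotated_getElem (s : List V) {i j : ℕ} (hij : i < j)
    (hj : j < s.length) : ∃ l l', s ~r s[i] :: (l ++ s[j] :: l') ∧
      l.length + 1 = j - i ∧ l'.length + 1 = s.length - (j - i) := by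
  refine ⟨(s.drop (i + 1)).take (j - i - 1), s.drop (j + 1) ++ s.take i, ?_, ?_, ?_⟩
  · have h1 : s = s.take i ++ s[i] :: ((s.drop (i + 1)).take (j - i - 1) ++ s[j] ::
        s.drop (j + 1)) := by
      have h2 : s.drop j = s[j] :: s.drop (j + 1) := List.drop_eq_getElem_cons hj
      have h3 : s.drop i = s[i] :: s.drop (i + 1) := List.drop_eq_getElem_cons (by omega)
      have h4 : s.drop (i + 1) = (s.drop (i + 1)).take (j - i - 1) ++ s.drop j := by
        conv_lhs => rw [← List.take_append_drop (j - i - 1) (s.drop (i + 1)), List.drop_drop]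
        congr 2
        omega
      rw [← h2, ← h4, ← h3, List.take_append_drop]
    have h5 : (s[i] :: ((s.drop (i + 1)).take (j - i - 1) ++ s[j] ::
        (s.drop (j + 1) ++ s.take i))) = (s[i] :: ((s.drop (i + 1)).take (j - i - 1) ++ s[j] ::
        s.drop (j + 1))) ++ s.take i := by
      simp only [List.cons_append, List.append_assoc]
    rw [h5]
    conv_lhs => rw [h1]
    exact List.isRotated_append
  · simp; omega
  · simp; omega

/-! ### Richness -/

/-- `U` is not separated from the members of `𝓕` by fewer than `k` vertices. -/
def Rich (G : SimpleGraph V) (𝓕 : Set (Set V)) (k : ℕ) (U : Set V) : Prop :=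
  ∀ T : Finset V, T.card < k → ∃ F ∈ 𝓕, Disjoint F (T : Set V) ∧
    ∃ u ∈ U, ∃ f ∈ F, G.JoinedOff T u f

namespace Rich

variable {𝓕 : Set (Set V)} {k l : ℕ} {U U' : Set V}

theorem mono (h : G.Rich 𝓕 k U) (hl : l ≤ k) (hU : U ⊆ U') : G.Rich 𝓕 l U' := by
  intro T hT
  obtain ⟨F, hF, hd, u, hu, hf⟩ := h T (by omega)
  exact ⟨F, hF, hd, u, hU hu, hf⟩

/-- Separators with at most `k - 1` and `l - 1` vertices together separate the union. -/
theorem left_or_right [DecidableEq V] (h : G.Rich 𝓕 (k + l - 1) (U ∪ U')) :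
    G.Rich 𝓕 k U ∨ G.Rich 𝓕 l U' := by
  by_contra hcon
  rw [not_or, Rich, Rich] at hcon
  push Not at hcon
  obtain ⟨⟨T, hT, h1⟩, T', hT', h2⟩ := hcon
  have hcard := Finset.card_union_le T T'
  obtain ⟨F, hF, hd, u, hu, f, hf, hj⟩ := h (T ∪ T') (by omega)
  rw [Finset.coe_union] at hj hd
  rcases hu with hu | hu
  · exact h1 F hF (hd.mono_right Set.subset_union_left) u hu f hf (hj.mono Set.subset_union_left)
  · exact h2 F hF (hd.mono_right Set.subset_union_right) u hu f hf
      (hj.mono Set.subset_union_right)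

theorem of_iUnion {ι : Type*} [Fintype ι] {U : ι → Set V}
    (h : G.Rich 𝓕 (Fintype.card ι * k + 1) (⋃ i, U i)) : ∃ i, G.Rich 𝓕 (k + 1) (U i) := by
  classical
  by_contra hcon
  simp only [Rich] at hcon
  push Not at hcon
  choose T hT hT' using hcon
  obtain ⟨F, hF, hd, u, hu, f, hf, hj⟩ := h (Finset.univ.biUnion T) (by
    refine Nat.lt_succ_of_le (Finset.card_biUnion_le_card_mul _ _ _ fun i _ => ?_)
    have := hT i
    omega)
  obtain ⟨i, hi⟩ := Set.mem_iUnion.1 hu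
  have hsub : (T i : Set V) ⊆ (Finset.univ.biUnion T : Finset V) := by
    rw [Finset.coe_subset]
    exact Finset.subset_biUnion_of_mem T (Finset.mem_univ i)
  exact hT' i F hF (hd.mono_right hsub) u hi f hf (hj.mono hsub)

/-- A set is separated from everything by itself. -/
theorem le_length {c : List V} (h : G.Rich 𝓕 k {v | v ∈ c}) : k ≤ c.length := by
  classical
  by_contra hlt
  obtain ⟨F, -, -, u, hu, f, -, hj⟩ := h c.toFinset
    (lt_of_le_of_lt c.toFinset_card_le (by omega))
  exact hj.left_notMem (by simpa using hu)

/-- A rich list has a prefix that is exactly as rich as wanted. -/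
theorem exists_append {s : List V} (h : G.Rich 𝓕 (k + l) {v | v ∈ s})
    (hl : 1 ≤ l) : ∃ c₁ c₂, s = c₁ ++ c₂ ∧ G.Rich 𝓕 k {v | v ∈ c₁} ∧
      (0 < k → ¬ G.Rich 𝓕 (k + 1) {v | v ∈ c₁}) ∧ G.Rich 𝓕 l {v | v ∈ c₂} := by
  classical
  have hex : ∃ i, G.Rich 𝓕 k {v | v ∈ s.take i} :=
    ⟨s.length, by rw [List.take_length]; exact h.mono (by omega) le_rfl⟩
  -- A single vertex is not `2`-rich, so the last vertex of the shortest `k`-rich prefix adds at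
  -- most one to the richness.
  have hnot : 0 < k → ¬ G.Rich 𝓕 (k + 1) {v | v ∈ s.take (Nat.find hex)} := by
    intro hk hr
    rcases hi : Nat.find hex with _ | i
    · rw [hi] at hr
      have := hr.le_length
      simp at this
    have hi' : i < s.length := by
      by_contra hge
      refine Nat.find_min hex (m := i) (by omega) ?_
      rw [List.take_of_length_le (by omega)]
      exact h.mono (by omega) le_rfl
    rw [hi] at hr
    have heq : {v | v ∈ s.take (i + 1)} = {v | v ∈ s.take i} ∪ {v | v ∈ [s[i]]} := by
      ext v
      rw [← List.take_concat_get' s i hi']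
      simp only [List.mem_append, Set.mem_ofPred_eq, Set.mem_union]
    rw [heq] at hr
    rcases left_or_right (k := k) (l := 2) hr with h1 | h1
    · exact Nat.find_min hex (m := i) (by omega) h1
    · have := h1.le_length
      simp at this
  refine ⟨s.take (Nat.find hex), s.drop (Nat.find hex), (List.take_append_drop _ _).symm,
    Nat.find_spec hex, hnot, ?_⟩
  by_cases hk : k = 0
  · subst hk
    have : Nat.find hex = 0 := by
      rw [Nat.find_eq_zero]
      exact fun T hT => absurd hT (by omega)
    rw [this]
    simpa using h
  rw [← List.take_append_drop (Nat.find hex) s] at h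
  have heq : {v | v ∈ s.take (Nat.find hex) ++ s.drop (Nat.find hex)} =
      {v | v ∈ s.take (Nat.find hex)} ∪ {v | v ∈ s.drop (Nat.find hex)} := by
    ext v
    simp only [List.mem_append]
    rfl
  rw [heq] at h
  -- Since the prefix is not `k + 1`-rich, the remainder loses only `k`.
  exact (left_or_right (k := k + 1) (l := l) (h.mono (by omega) le_rfl)).resolve_left
    (hnot (by omega))

end Rich

/-! ### Connected intersecting families and rigid sets -/

/-- A family of connected vertex sets that pairwise meet. -/
structure IsConnectedIntersecting (G : SimpleGraph V) (𝓕 : Set (Set V)) : Prop where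
  inter : ∀ F ∈ 𝓕, ∀ F' ∈ 𝓕, (F ∩ F').Nonempty
  conn : ∀ F ∈ 𝓕, ∀ x ∈ F, ∀ y ∈ F, G.JoinedOff Fᶜ x y

namespace IsConnectedIntersecting

variable {𝓕 : Set (Set V)}

theorem joinedOff (h𝓕 : G.IsConnectedIntersecting 𝓕) {F F' T : Set V} (hF : F ∈ 𝓕)
    (hF' : F' ∈ 𝓕) (hT : Disjoint F T) (hT' : Disjoint F' T) {x y : V} (hx : x ∈ F)
    (hy : y ∈ F') : G.JoinedOff T x y := by
  obtain ⟨z, hz, hz'⟩ := h𝓕.inter F hF F' hF'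
  exact ((h𝓕.conn F hF x hx z hz).mono hT.subset_compl_left).trans
    ((h𝓕.conn F' hF' z hz' y hy).mono hT'.subset_compl_left)

/-- Each rich set reaches a member avoiding `T`, and these two members meet; thus rich sets are also
hard to separate from each other. -/
theorem exists_joinedOff (h𝓕 : G.IsConnectedIntersecting 𝓕) {k : ℕ} {U U' : Set V}
    (h : G.Rich 𝓕 k U) (h' : G.Rich 𝓕 k U') {T : Finset V} (hT : T.card < k) :
    ∃ F ∈ 𝓕, Disjoint F (T : Set V) ∧ ∃ u ∈ U, ∃ u' ∈ U', ∃ f ∈ F,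
      G.JoinedOff T u f ∧ G.JoinedOff T u u' := by
  obtain ⟨F, hF, hd, u, hu, f, hf, hj⟩ := h T hT
  obtain ⟨F', hF', hd', u', hu', f', hf', hj'⟩ := h' T hT
  exact ⟨F, hF, hd, u, hu, u', hu', f, hf, hj,
    (hj.trans (h𝓕.joinedOff hF hF' hd hd' hf hf')).trans hj'.symm⟩

end IsConnectedIntersecting

variable {𝓕 : Set (Set V)}

/-- `F` consists of `m` walks, none of which can be made longer by a detour off `F`. -/
def IsRigid (G : SimpleGraph V) (m : ℕ) (F : Set V) : Prop :=
  ∃ (u v : Fin m → V) (p : ∀ i, G.Walk (u i) (v i)),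
    F = {x | ∃ i, x ∈ (p i).support} ∧ (∀ i, ¬ (p i).Nil) ∧ (∀ i, (p i).interior.Nodup) ∧
    ∀ i a b x y, a < b → b ≤ (p i).length → x = (p i).getVert a → y = (p i).getVert b → x ≠ y →
      ∀ Q : G.Walk x y, Q.IsPath → (∀ z ∈ Q.support, z ∈ F → z = x ∨ z = y) → Q.length ≤ b - a

/-! ### Short walks and rich cycles -/

/-- Two rich sets are joined by a short walk, by breadth-first search. -/
theorem IsConnectedIntersecting.exists_short_walk [Fintype V] (h𝓕 : G.IsConnectedIntersecting 𝓕)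
    {k : ℕ} {A B : Set V} (hk : 0 < k) (hA : G.Rich 𝓕 k A) (hB : G.Rich 𝓕 k B) :
    ∃ a ∈ A, ∃ b ∈ B, ∃ w : G.Walk a b, (w.length + 1) * k ≤ Fintype.card V := by
  classical
  have hex : ∃ L, ∃ a ∈ A, ∃ b ∈ B, ∃ w : G.Walk a b, w.length = L := by
    obtain ⟨-, -, -, a, ha, b, hb, -, -, -, w, -⟩ := h𝓕.exists_joinedOff hA hB (T := ∅) (by simpa)
    exact ⟨_, a, ha, b, hb, w, rfl⟩
  obtain ⟨a, ha, b, hb, w, hw⟩ := Nat.find_spec hex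
  have hmin : ∀ a' ∈ A, ∀ b' ∈ B, ∀ w' : G.Walk a' b', w.length ≤ w'.length :=
    fun a' ha' b' hb' w' => hw ▸ Nat.find_min' hex ⟨a', ha', b', hb', w', rfl⟩
  refine ⟨a, ha, b, hb, w, ?_⟩
  -- `D i` is the layer at distance exactly `i` from `A`. Each layer up to the distance of `B`
  -- separates `A` from `B`, so it has at least `k` vertices.
  let D : ℕ → Finset V := fun i => Finset.univ.filter fun v =>
    (∃ a ∈ A, ∃ q : G.Walk a v, q.length = i) ∧ ∀ a ∈ A, ∀ q : G.Walk a v, i ≤ q.length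
  have hdisj : ((Finset.range (w.length + 1) : Finset ℕ) : Set ℕ).PairwiseDisjoint D := by
    intro i _ j _ hij
    rw [Function.onFun, Finset.disjoint_left]
    intro v hi hj
    obtain ⟨⟨a, ha, q, hq⟩, hi⟩ := (Finset.mem_filter.1 hi).2
    obtain ⟨⟨a', ha', q', hq'⟩, hj⟩ := (Finset.mem_filter.1 hj).2
    have h1 := hi a' ha' q'
    have h2 := hj a ha q
    omega
  have hcard : ∀ i ∈ Finset.range (w.length + 1), k ≤ (D i).card := by
    intro i hi
    by_contra hlt
    obtain ⟨-, -, -, a', ha', b', hb', -, -, -, w', hw'⟩ :=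
      h𝓕.exists_joinedOff hA hB (T := D i) (by omega)
    have claim : ∀ (u v : V) (q : G.Walk u v), (∀ z ∈ q.support, z ∉ D i) →
        (∃ a ∈ A, ∃ q : G.Walk a u, q.length < i) → ∃ a ∈ A, ∃ q : G.Walk a v, q.length < i := by
      intro u v q
      induction q with
      | nil => exact fun _ h => h
      | @cons u u' v huu q ih =>
        rintro hq ⟨a, ha, r, hr⟩
        refine ih (fun z hz => hq z (by simp [hz])) ?_
        by_contra hcon
        push Not at hcon
        refine hq u' (by simp) (Finset.mem_filter.2 ⟨Finset.mem_univ _,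
          ⟨a, ha, r.concat huu, ?_⟩, hcon⟩)
        have := hcon a ha (r.concat huu)
        rw [Walk.length_concat] at this ⊢
        omega
    have h0 : 0 < i := by
      by_contra h0
      refine hw' a' w'.start_mem_support (Finset.mem_coe.2 (Finset.mem_filter.2
        ⟨Finset.mem_univ _, ⟨a', ha', .nil, ?_⟩, fun _ _ _ => ?_⟩))
      · rw [Walk.length_nil]; omega
      · omega
    obtain ⟨a'', ha'', q, hq⟩ := claim a' b' w' (fun z hz => hw' z hz)
      ⟨a', ha', .nil, by simpa using h0⟩
    have h1 := hmin a'' ha'' b' hb' q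
    rw [Finset.mem_range] at hi
    omega
  calc (w.length + 1) * k = ∑ i ∈ Finset.range (w.length + 1), k := by simp
    _ ≤ ∑ i ∈ Finset.range (w.length + 1), (D i).card := Finset.sum_le_sum hcard
    _ = ((Finset.range (w.length + 1)).biUnion D).card := (Finset.card_biUnion hdisj).symm
    _ ≤ Fintype.card V := Finset.card_le_univ _

theorem Walk.length_interior {x y : V} (q : G.Walk x y) (h : ¬ q.Nil) :
    q.interior.length + 1 = q.length := by
  have h1 := q.length_support
  rw [q.support_eq_interior h] at h1
  simp at h1
  omega

/-- Replacing an arc of a cycle by a chord. -/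
theorem isCyclicList_of_chord {x y : V} {l : List V} {B : Set V} (hxy : x ≠ y)
    (hnd : (x :: (l ++ [y])).Nodup) (hch : (x :: (l ++ [y])).IsChain G.Adj) (q : G.Walk x y)
    (hq : q.IsPath) (hqB : ∀ z ∈ q.support, z ∈ B → z = x ∨ z = y) (hl : ∀ z ∈ l, z ∈ B) :
    G.IsCyclicList (x :: (l ++ y :: q.reverse.interior)) := by
  have hnil : ¬ q.reverse.Nil := fun h => hxy h.eq.symm
  have hs := q.reverse.support_eq_interior hnil
  refine isCyclicList_iff_arcs.2 ⟨?_, hch, ?_⟩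
  · have h1 : (y :: (q.reverse.interior ++ [x])).Nodup := by
      rw [← hs]
      exact hq.reverse.support_nodup
    have h2 : ∀ z ∈ l, z ∉ q.reverse.interior := by
      intro z hz hzi
      have h3 : z ∈ q.support := by
        rw [← List.mem_reverse, ← Walk.support_reverse, hs]
        simp [hzi]
      rcases hqB z h3 (hl z hz) with rfl | rfl
      · simp [hz] at hnd
      · simp [List.nodup_append] at hnd
        exact absurd rfl (hnd.2.2 z hz)
    simp only [List.nodup_cons, List.nodup_append, List.mem_append, List.mem_cons] at h1 hnd ⊢
    grind
  · rw [← hs]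
    exact q.reverse.isChain_adj_support

/-- A path with a rich vertex set contains enough to close a rich cycle. -/
theorem IsConnectedIntersecting.exists_isCyclicList (h𝓕 : G.IsConnectedIntersecting 𝓕) {b : ℕ}
    (hb : 0 < b) {I : List V} (hnd : I.Nodup) (hch : I.IsChain G.Adj)
    (hI : G.Rich 𝓕 ((b + 1) + (b + (b + 1))) {v | v ∈ I}) :
    ∃ c, G.IsCyclicList c ∧ G.Rich 𝓕 b {v | v ∈ c} := by
  classical
  -- The path is cut into `J`, `M`, `J'`, where `M` is `b`-rich but not `b + 1`-rich and the outer
  -- parts are `b + 1`-rich. At most `b` vertices `T` cut `M` off from the members avoiding `T`,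
  -- while `J` and `J'` stay joined to such a member and to each other; the walk joining them
  -- therefore misses `M` and closes a cycle through it.
  obtain ⟨J, R, rfl, hJ, -, hR⟩ := hI.exists_append (by omega)
  obtain ⟨M, J', rfl, hM, hM', hJ'⟩ := hR.exists_append (by omega)
  have hM' := hM' hb
  rw [Rich] at hM'
  push Not at hM'
  obtain ⟨T, hT, hTM⟩ := hM'
  obtain ⟨F, hF, hd, u, hu, u', hu', f, hf, hj, w, hw⟩ := h𝓕.exists_joinedOff hJ hJ' hT
  have hwM : ∀ z ∈ w.support, z ∉ M := fun z hz hzM =>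
    hTM F hF hd z hzM f hf (JoinedOff.trans (JoinedOff.symm ⟨w.takeUntil z hz, fun t ht =>
      hw t (w.support_takeUntil_subset_support hz ht)⟩) hj)
  obtain ⟨x, hx, y, hy, q, hq, hqw, hqJ, hqJ'⟩ := w.exists_isPath_between hu hu'
  obtain ⟨a₁, a₂, rfl⟩ := List.append_of_mem (show x ∈ J from hx)
  obtain ⟨b₁, b₂, rfl⟩ := List.append_of_mem (show y ∈ J' from hy)
  have heq : a₁ ++ x :: a₂ ++ (M ++ (b₁ ++ y :: b₂)) =
      a₁ ++ ((x :: ((a₂ ++ M ++ b₁) ++ [y])) ++ b₂) := by simp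
  rw [heq] at hnd hch
  have hnd' : (x :: ((a₂ ++ M ++ b₁) ++ [y])).Nodup :=
    hnd.of_append_right.of_append_left
  have hch' : (x :: ((a₂ ++ M ++ b₁) ++ [y])).IsChain G.Adj :=
    (hch.right_of_append).left_of_append
  have hxy : x ≠ y := by
    rintro rfl
    simp at hnd'
  refine ⟨_, isCyclicList_of_chord (B := {z | z ∈ a₂ ++ M ++ b₁}) hxy hnd' hch' q hq ?_
    (fun z hz => hz), hM.mono le_rfl ?_⟩
  · intro z hz hzB
    simp only [Set.mem_ofPred_eq, List.mem_append] at hzB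
    rcases hzB with (h | h) | h
    · exact .inl (hqJ z hz (by simp [h]))
    · exact absurd h (hwM z (hqw hz))
    · exact .inr (hqJ' z hz (by simp [h]))
  · intro z hz
    simp only [Set.mem_ofPred_eq] at hz
    simp [hz]

/-- In a shortest rich cycle, a walk is at least as long as the cyclic distance of its ends, provided
that rich cycles are twice as rich as they need to be. -/
theorem IsCyclicList.min_le_length {s : List V} {b : ℕ} (hs : G.IsCyclicList s)
    (hrich : G.Rich 𝓕 (b + b - 1) {v | v ∈ s})
    (hmin : ∀ c, G.IsCyclicList c → G.Rich 𝓕 b {v | v ∈ c} → s.length ≤ c.length)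
    {i j : ℕ} {x y : V} (hi : s[i]? = some x) (hj : s[j]? = some y) (w : G.Walk x y) :
    min (max i j - min i j) (s.length - (max i j - min i j)) ≤ w.length := by
  classical
  have hinj : ∀ {i j : ℕ} {x : V}, s[i]? = some x → s[j]? = some x → i = j := by
    intro i j x hi hj
    obtain ⟨hi', hi⟩ := List.getElem?_eq_some_iff.1 hi
    obtain ⟨hj', hj⟩ := List.getElem?_eq_some_iff.1 hj
    exact (hs.1.getElem_inj_iff).1 (hi.trans hj.symm)
  -- The chord forms a cycle with each of the two arcs. Their union covers `s`, so one of them is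
  -- `b`-rich and hence not shorter than `s`: the chord is at least as long as the arc it replaces.
  have chord_lt : ∀ {i j : ℕ} {x y : V}, i < j → s[i]? = some x → s[j]? = some y →
      ∀ q : G.Walk x y, q.IsPath → (∀ z ∈ q.support, z ∈ s → z = x ∨ z = y) →
      min (j - i) (s.length - (j - i)) ≤ q.length := by
    intro i j x y hij hi hj q hq hqs
    have hxy : x ≠ y := by
      rintro rfl
      exact hij.ne (hinj hi hj)
    obtain ⟨hi', rfl⟩ := List.getElem?_eq_some_iff.1 hi
    obtain ⟨hj', rfl⟩ := List.getElem?_eq_some_iff.1 hj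
    obtain ⟨l, l', hrot, hl, hl'⟩ := isRotated_getElem s hij hj'
    obtain ⟨hnd, h1, h2⟩ := isCyclicList_iff_arcs.1 (hs.of_isRotated hrot)
    have hmem := fun z => hrot.mem_iff (a := z)
    have hnd1 : (s[i] :: (l ++ [s[j]])).Nodup := by
      simp only [List.nodup_cons, List.nodup_append, List.mem_append, List.mem_cons] at hnd ⊢
      grind
    have hnd2 : (s[j] :: (l' ++ [s[i]])).Nodup := by
      simp only [List.nodup_cons, List.nodup_append, List.mem_append, List.mem_cons] at hnd ⊢
      grind
    have hc1 := isCyclicList_of_chord (B := {v | v ∈ s}) hxy hnd1 h1 q hq hqs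
      (fun z hz => (hmem z).2 (by simp [hz]))
    have hc2 := isCyclicList_of_chord (B := {v | v ∈ s}) hxy.symm hnd2 h2 q.reverse hq.reverse
      (fun z hz hzs => (hqs z (by simpa using hz) hzs).symm) (fun z hz => (hmem z).2 (by simp [hz]))
    have hlen1 := q.reverse.length_interior fun h => hxy h.eq.symm
    have hlen2 := q.reverse.reverse.length_interior fun h => hxy h.eq
    rw [Walk.length_reverse] at hlen1 hlen2
    rw [Walk.length_reverse] at hlen2
    have hsub : {v | v ∈ s} ⊆ {v | v ∈ s[i] :: (l ++ s[j] :: q.reverse.interior)} ∪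
        {v | v ∈ s[j] :: (l' ++ s[i] :: q.reverse.reverse.interior)} := by
      intro z hz
      have := (hmem z).1 hz
      simp only [Set.mem_union, Set.mem_ofPred_eq]
      simp at this ⊢
      tauto
    rcases (hrich.mono le_rfl hsub).left_or_right with h | h
    · have := hmin _ hc1 h
      simp at this
      omega
    · have := hmin _ hc2 h
      simp only [List.length_cons, List.length_append] at this
      omega
  have chord : ∀ {i j : ℕ} {x y : V}, i ≠ j → s[i]? = some x → s[j]? = some y →
      ∀ q : G.Walk x y, (∀ z ∈ q.support, z ∈ s → z = x ∨ z = y) →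
      min (max i j - min i j) (s.length - (max i j - min i j)) ≤ q.length := by
    intro i j x y hij hi hj q hqs
    have hle := q.length_bypass_le_length
    have hsub := q.support_bypass_subset_support
    rcases Nat.lt_or_gt_of_ne hij with h | h
    · have := chord_lt h hi hj q.bypass q.bypass_isPath fun z hz => hqs z (hsub hz)
      omega
    · have := chord_lt h hj hi q.bypass.reverse q.bypass_isPath.reverse fun z hz hzs =>
        (hqs z (hsub (by simpa using hz)) hzs).symm
      rw [Walk.length_reverse] at this
      omega
  -- The walk is cut at its first return to `s`; the initial piece is a chord, and cyclic distances
  -- satisfy the triangle inequality.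
  induction hk : w.length using Nat.strong_induction_on generalizing i x with
  | _ k ih =>
  subst hk
  by_cases hxy : x = y
  · subst hxy
    have := hinj hi hj
    omega
  have hex : ∃ t, 0 < t ∧ w.getVert t ∈ s := by
    refine ⟨w.length, ?_, ?_⟩
    · rw [Nat.pos_iff_ne_zero]
      exact fun h => hxy (Walk.eq_of_length_eq_zero h)
    · rw [Walk.getVert_length]
      exact List.mem_of_getElem? hj
  obtain ⟨ht0, hts⟩ := Nat.find_spec hex
  have htle : Nat.find hex ≤ w.length := Nat.find_min' hex ⟨by
    rw [Nat.pos_iff_ne_zero]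
    exact fun h => hxy (Walk.eq_of_length_eq_zero h), by
      rw [Walk.getVert_length]
      exact List.mem_of_getElem? hj⟩
  have htmin : ∀ r, 0 < r → r < Nat.find hex → w.getVert r ∉ s := fun r hr hr' hrs =>
    Nat.find_min hex hr' ⟨hr, hrs⟩
  generalize Nat.find hex = t at *
  obtain ⟨z, hz⟩ := List.mem_iff_getElem?.1 hts
  have hrec := ih (w.drop t).length (by rw [Walk.drop_length]; omega) hz (w.drop t) rfl
  rw [Walk.drop_length] at hrec
  by_cases hiz : i = z
  · subst hiz
    omega
  have hch := chord hiz hi hz (w.take t) (by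
    intro v hv hvs
    obtain ⟨r, hr, hrl⟩ := Walk.mem_support_iff_exists_getVert.1 hv
    rw [Walk.take_length] at hrl
    rw [Walk.take_getVert, min_eq_right (by omega)] at hr
    by_cases hr0 : r = 0
    · subst hr0
      exact .inl (by rw [← hr, Walk.getVert_zero])
    by_cases hrt : r = t
    · exact .inr (by rw [← hr, hrt])
    · exact absurd (hr ▸ hvs) (htmin r (by omega) (by omega)))
  rw [Walk.take_length] at hch
  have hzl := (List.getElem?_eq_some_iff.1 hz).1
  have hil := (List.getElem?_eq_some_iff.1 hi).1
  have hjl := (List.getElem?_eq_some_iff.1 hj).1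
  omega

/-- Shortest rich cycles do not exist if rich cycles are very rich. -/
theorem IsConnectedIntersecting.false_of_isCyclicList [Fintype V]
    (h𝓕 : G.IsConnectedIntersecting 𝓕) {b k l N : ℕ} (hb : b + b ≤ N) (hk : 0 < k)
    (hl : 0 < l) (hN : k + (l + (k + l)) ≤ N) (hkl : Fintype.card V < (l + 2) * k)
    (hup : ∀ c, G.IsCyclicList c → G.Rich 𝓕 b {v | v ∈ c} → G.Rich 𝓕 N {v | v ∈ c})
    (hex : ∃ c, G.IsCyclicList c ∧ G.Rich 𝓕 b {v | v ∈ c}) : False := by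
  classical
  have hex' : ∃ L, ∃ c, G.IsCyclicList c ∧ G.Rich 𝓕 b {v | v ∈ c} ∧ c.length = L := by
    obtain ⟨c, hc, hr⟩ := hex
    exact ⟨_, c, hc, hr, rfl⟩
  obtain ⟨s, hs, hsr, hsl⟩ := Nat.find_spec hex'
  have hmin : ∀ c, G.IsCyclicList c → G.Rich 𝓕 b {v | v ∈ c} → s.length ≤ c.length :=
    fun c hc hr => hsl ▸ Nat.find_min' hex' ⟨c, hc, hr, rfl⟩
  have hsN := hup s hs hsr
  -- Four consecutive arcs of richness `k`, `l`, `k`, `l`: the first and third are joined by a short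
  -- walk, yet the other two, with at least `l` vertices each, put its ends at cyclic distance at
  -- least `l + 1`.
  obtain ⟨I₁, R₁, rfl, h1, -, hR⟩ := (hsN.mono hN le_rfl).exists_append (by omega)
  obtain ⟨I₂, R₂, rfl, h2, -, hR⟩ := hR.exists_append (by omega)
  obtain ⟨I₃, I₄, rfl, h3, -, h4⟩ := hR.exists_append (by omega)
  obtain ⟨x, hx, y, hy, w, hw⟩ := h𝓕.exists_short_walk hk h1 h3
  obtain ⟨i, hi⟩ := List.mem_iff_getElem?.1 hx
  obtain ⟨j, hj⟩ := List.mem_iff_getElem?.1 hy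
  have hil := (List.getElem?_eq_some_iff.1 hi).1
  have hjl := (List.getElem?_eq_some_iff.1 hj).1
  have h2l := h2.le_length
  have h4l := h4.le_length
  have hwl := hs.min_le_length (i := i) (j := I₁.length + (I₂.length + j))
    (hsN.mono (by omega) le_rfl) hmin
    (by rw [List.getElem?_append_left hil, hi])
    (by
      rw [List.getElem?_append_right (by omega), List.getElem?_append_right (by omega),
        List.getElem?_append_left (by omega), ← hj]
      congr 1
      omega) w
  simp only [List.length_append] at hwl
  have : l + 2 ≤ w.length + 1 := by omega
  have := Nat.mul_le_mul_right k this
  omega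

/-! ### Rigid members and the transversal -/

/-- A long cycle that avoids a rigid member of the family is not rich. -/
theorem IsCyclicList.not_disjoint [Fintype V] (h𝓕 : G.IsConnectedIntersecting 𝓕) {m d k : ℕ}
    {c : List V} (hc : G.IsCyclicList c) (hd : 0 < d) (hcd : 2 * d ≤ c.length) {F : Set V}
    (hF : F ∈ 𝓕) (hrig : G.IsRigid m F) (hk : m * ((Fintype.card V + 1) / d + 1) < k)
    (hrich : G.Rich 𝓕 k {v | v ∈ c}) : ∃ v ∈ F, v ∈ c := by
  classical
  by_contra hcF
  push Not at hcF
  obtain ⟨u, v, p, hFp, hnil, hnd, hdet⟩ := hrig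
  have : Nonempty V := ⟨c.head (List.ne_nil_of_length_pos (by omega))⟩
  -- Each path is cut into blocks of at most `d` consecutive positions.
  let J : Fin m → ℕ → Set V := fun i b => {x | ∃ a ≤ (p i).length, a / d = b ∧ x = (p i).getVert a}
  -- By Menger, failure gives two disjoint walks from `c` to one block. With the longer arc of `c`,
  -- which has at least `d` edges, they form a detour longer than the stretch of fewer than `d`
  -- edges between its ends.
  have hcut : ∀ i b, ∃ t, ∀ x ∈ c, ∀ y ∈ J i b, ¬ G.JoinedOff ((F \ J i b) ∪ {t}) x y := by
    intro i b
    by_contra hcon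
    push Not at hcon
    obtain ⟨x₁, hx₁, y₁, hy₁, x₂, hx₂, y₂, hy₂, w₁, w₂, hdisj, hw₁, hw₂⟩ :=
      exists_disjoint_walks_off {x | x ∈ c} (J i b) (F \ J i b) hcon
    have hJF : J i b ⊆ F := by
      rintro x ⟨a, -, -, rfl⟩
      rw [hFp]
      exact ⟨i, Walk.getVert_mem_support _ _⟩
    obtain ⟨x₁, hx₁, y₁, hy₁, q₁, hq₁, hqw₁, hqc₁, hqF₁⟩ :=
      w₁.exists_isPath_between hx₁ (hJF hy₁)
    obtain ⟨x₂, hx₂, y₂, hy₂, q₂, hq₂, hqw₂, hqc₂, hqF₂⟩ :=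
      w₂.exists_isPath_between hx₂ (hJF hy₂)
    have hdisj' : ∀ z ∈ q₁.support, z ∉ q₂.support := fun z hz hz' =>
      hdisj (hqw₁ hz) (hqw₂ hz')
    have hxx : x₁ ≠ x₂ := fun h => hdisj' x₁ q₁.start_mem_support (h ▸ q₂.start_mem_support)
    have hyy : y₁ ≠ y₂ := fun h => hdisj' y₁ q₁.end_mem_support (h ▸ q₂.end_mem_support)
    obtain ⟨r, hr, hrc, hrl⟩ := hc.exists_long_arc hx₁ hx₂ hxx
    have hl₁ : 0 < q₁.length := by
      rw [Nat.pos_iff_ne_zero]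
      exact fun h => hcF y₁ hy₁ (Walk.eq_of_length_eq_zero h ▸ hx₁)
    have hJ₁ : y₁ ∈ J i b := by
      by_contra h
      exact hw₁ y₁ (hqw₁ q₁.end_mem_support) ⟨hy₁, h⟩
    have hJ₂ : y₂ ∈ J i b := by
      by_contra h
      exact hw₂ y₂ (hqw₂ q₂.end_mem_support) ⟨hy₂, h⟩
    obtain ⟨Q, hQ, hQF, hQl⟩ : ∃ Q : G.Walk y₁ y₂, Q.IsPath ∧
        (∀ z ∈ Q.support, z ∈ F → z = y₁ ∨ z = y₂) ∧ d < Q.length := by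
      refine ⟨q₁.reverse.append (r.append q₂), ?_, ?_, ?_⟩
      · have hn₁ := hq₁.reverse.support_nodup
        have hnr := hr.support_nodup
        have hn₂ := hq₂.support_nodup
        have er := r.cons_tail_support.symm
        have e2 := q₂.cons_tail_support.symm
        rw [Walk.isPath_def, Walk.support_append, Walk.tail_support_append,
          List.nodup_append', List.nodup_append']
        rw [er] at hnr
        rw [e2] at hn₂
        refine ⟨hn₁, ⟨hnr.of_cons, hn₂.of_cons, ?_⟩, ?_⟩
        · intro z hz hz'
          have h1 : z ∈ q₂.support := by rw [e2]; exact List.mem_cons_of_mem _ hz'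
          have h2 : z ∈ r.support := by rw [er]; exact List.mem_cons_of_mem _ hz
          have := hqc₂ z h1 (hrc z h2)
          subst this
          exact (List.nodup_cons.1 hn₂).1 hz'
        · intro z hz hz'
          rw [Walk.support_reverse, List.mem_reverse] at hz
          rcases List.mem_append.1 hz' with h | h
          · have h2 : z ∈ r.support := by rw [er]; exact List.mem_cons_of_mem _ h
            have := hqc₁ z hz (hrc z h2)
            subst this
            exact (List.nodup_cons.1 hnr).1 h
          · exact hdisj' z hz (by rw [e2]; exact List.mem_cons_of_mem _ h)
      · intro z hz hzF
        simp only [Walk.mem_support_append_iff, Walk.support_reverse, List.mem_reverse] at hz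
        rcases hz with hz | hz | hz
        · exact .inl (hqF₁ z hz hzF)
        · exact absurd (hrc z hz) (hcF z hzF)
        · exact .inr (hqF₂ z hz hzF)
      · simp only [Walk.length_append, Walk.length_reverse]
        omega
    obtain ⟨a₁, ha₁, hab₁, e₁⟩ := hJ₁
    obtain ⟨a₂, ha₂, hab₂, e₂⟩ := hJ₂
    have hm₁ := Nat.div_add_mod a₁ d
    have hm₂ := Nat.div_add_mod a₂ d
    have hlt₁ := Nat.mod_lt a₁ hd
    have hlt₂ := Nat.mod_lt a₂ hd
    rw [hab₁] at hm₁
    rw [hab₂] at hm₂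
    rcases lt_trichotomy a₁ a₂ with h | h | h
    · have := hdet i a₁ a₂ y₁ y₂ h ha₂ e₁ e₂ hyy Q hQ hQF
      omega
    · exact hyy (by rw [e₁, e₂, h])
    · have := hdet i a₂ a₁ y₂ y₁ h ha₁ e₂ e₁ hyy.symm Q.reverse hQ.reverse
        (fun z hz hzF => (hQF z (by simpa using hz) hzF).symm)
      rw [Walk.length_reverse] at this
      omega
  choose t ht using hcut
  let T : Finset V := (Finset.univ ×ˢ Finset.range ((Fintype.card V + 1) / d + 1)).image
    fun ib : Fin m × ℕ => t ib.1 ib.2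
  have hT : T.card < k := by
    refine lt_of_le_of_lt Finset.card_image_le ?_
    simpa using hk
  obtain ⟨F', hF', hdT, x, hx, f, hf, hj⟩ := hrich T hT
  obtain ⟨z, hzF, hzF'⟩ := h𝓕.inter F hF F' hF'
  obtain ⟨w, hw⟩ := hj.trans ((h𝓕.conn F' hF' f hf z hzF').mono hdT.subset_compl_left)
  -- The block where the walk first hits `F` is reached off its cut vertex, a contradiction.
  obtain ⟨x, hx, y, hy, q, -, hqw, -, hqF⟩ := w.exists_isPath_between hx hzF
  obtain ⟨i, hi⟩ : ∃ i, y ∈ (p i).support := by rwa [hFp] at hy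
  obtain ⟨a, rfl, ha⟩ := Walk.mem_support_iff_exists_getVert.1 hi
  -- Only interior vertices are known to be distinct; this accounts for the `+ 1` in the number of
  -- blocks.
  have hlen : (p i).length ≤ Fintype.card V + 1 := by
    have := (p i).length_interior (hnil i)
    have := (hnd i).length_le_card
    omega
  refine ht i (a / d) x hx _ ⟨a, ha, rfl, rfl⟩ ⟨q, fun z hz hz' => ?_⟩
  rcases hz' with hz' | hz'
  · exact hz'.2 (hqF z hz hz'.1 ▸ ⟨a, ha, rfl, rfl⟩)
  · rw [Set.mem_singleton_iff] at hz'
    refine hw z (hqw hz) ?_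
    rw [hz', Finset.mem_coe]
    refine Finset.mem_image.2 ⟨(i, a / d), ?_, rfl⟩
    simp only [Finset.mem_product, Finset.mem_univ, true_and, Finset.mem_range]
    exact Nat.lt_succ_of_le (Nat.div_le_div_right (by omega))

/-- A pairwise intersecting family of rigid connected sets has a small transversal. -/
theorem IsConnectedIntersecting.exists_transversal [Fintype V]
    (h𝓕 : G.IsConnectedIntersecting 𝓕) {m d l N : ℕ} (hrig : ∀ F ∈ 𝓕, G.IsRigid m F)
    (hd : 0 < d) (hmd : m * ((Fintype.card V + 1) / d + 1) < 2 * d)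
    (hl : 0 < l) (hlV : Fintype.card V < (l + 2) * l) (hlN : 4 * l ≤ N) (hdN : 4 * d ≤ N)
    (hmN : m * (6 * d + 3) + 1 ≤ N) : ∃ T : Finset V, T.card < N ∧ ∀ F ∈ 𝓕, ∃ v ∈ T, v ∈ F := by
  classical
  by_contra hcon
  push Not at hcon
  have hav : ∀ T : Finset V, T.card < N → ∃ F ∈ 𝓕, Disjoint F (T : Set V) := by
    intro T hT
    obtain ⟨F, hF, hFT⟩ := hcon T hT
    exact ⟨F, hF, Set.disjoint_right.2 fun v hv => hFT v hv⟩
  have htrans : ∀ U : Set V, (∀ F ∈ 𝓕, ∃ v ∈ F, v ∈ U) → G.Rich 𝓕 N U := by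
    intro U hU T hT
    obtain ⟨F, hF, hd⟩ := hav T hT
    obtain ⟨v, hv, hvU⟩ := hU F hF
    exact ⟨F, hF, hd, v, hvU, v, hv, .refl (Set.disjoint_left.1 hd hv)⟩
  -- A `2 * d`-rich cycle has at least `2 * d` vertices, as the detour argument needs.
  refine h𝓕.false_of_isCyclicList (b := 2 * d) (N := N) (by omega) hl hl (by omega) hlV ?_ ?_
  · intro c hc hr
    exact htrans _ fun F hF =>
      hc.not_disjoint h𝓕 hd hr.le_length hF (hrig F hF) hmd hr
  · obtain ⟨F, hF, -⟩ := hav ∅ (by simp; omega)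
    have hFr := htrans F fun F' hF' => h𝓕.inter F' hF' F hF
    obtain ⟨u, v, p, hFp, hnil, hnd, -⟩ := hrig F hF
    -- Some path is `6 * d + 4`-rich. Dropping its two ends leaves `6 * d + 2 = (b + 1) + (b + (b +
    -- 1))` for `b = 2 * d`.
    obtain ⟨i, hi⟩ := Rich.of_iUnion (k := 6 * d + 3) (U := fun i : Fin m => {x | x ∈ (p i).support})
      (hFr.mono (by simpa using hmN) (by
        intro x hx
        rw [hFp] at hx
        simpa using hx))
    have hsub : {x | x ∈ (p i).support} ⊆
        ({x | x ∈ (p i).interior} ∪ {x | x ∈ [v i]}) ∪ {x | x ∈ [u i]} := by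
      intro x hx
      simp only [Set.mem_ofPred_eq, (p i).support_eq_interior (hnil i)] at hx
      simp at hx ⊢
      tauto
    have hsing : ∀ x : V, ¬ G.Rich 𝓕 2 {y | y ∈ [x]} := fun x h => by simpa using h.le_length
    have h1 := ((hi.mono (l := (6 * d + 3) + 2 - 1) (by omega) hsub).left_or_right).resolve_right
      (hsing _)
    have h2 := ((h1.mono (l := (6 * d + 2) + 2 - 1) (by omega) le_rfl).left_or_right).resolve_right
      (hsing _)
    refine h𝓕.exists_isCyclicList (by omega) (hnd i) ?_ (h2.mono (by omega) le_rfl)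
    have hch := (p i).isChain_adj_support
    rw [(p i).support_eq_interior (hnil i), ← List.singleton_append] at hch
    exact hch.right_of_append.left_of_append

end SimpleGraph

/-! ### Subdivisions: detours, rigidity, connectedness -/

section Subdivisions

open SimpleGraph

variable {α β V : Type*} {R : Graph α β} {G : SimpleGraph V}

/-- The interior omits the start, so position `j` of the walk is entry `j - 1`. -/
theorem SimpleGraph.Walk.interior_append_append {u v : V} (p : G.Walk u v) (hp : ¬ p.Nil)
    {i j : ℕ} (hij : i < j) (hj : j ≤ p.length) (Q : G.Walk (p.getVert i) (p.getVert j))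
    (hQ : ¬ Q.Nil) : (((p.take i).append Q).append (p.drop j)).interior =
      p.interior.take i ++ Q.interior ++ p.interior.drop (j - 1) := by
  have hl := p.length_interior hp
  have h1 : (p.take i).support = u :: p.interior.take i := by
    rw [Walk.support_take, p.support_eq_interior hp, List.take_succ_cons,
      List.take_append_of_le_length (by omega)]
  have h2 : (p.drop j).support = p.interior.drop (j - 1) ++ [v] := by
    obtain ⟨j, rfl⟩ : ∃ j', j = j' + 1 := ⟨j - 1, by omega⟩
    rw [Walk.drop_support_eq_support_drop_min, min_eq_left hj, p.support_eq_interior hp,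
      List.drop_succ_cons, List.drop_append_of_le_length (by omega)]
    simp
  rw [Walk.interior, Walk.support_append_eq_support_dropLast_append, Walk.support_append, h1, h2,
    Q.support_eq_interior hQ, List.tail_cons, ← List.append_assoc (u :: _),
    List.dropLast_concat]
  rw [← List.append_assoc, List.cons_append, List.cons_append, List.cons_append, List.tail_cons,
    List.dropLast_concat]

theorem SimpleGraph.Walk.IsPath.length_le_one {u v : V} {Q : G.Walk u v} (hQ : Q.IsPath)
    (h : s(u, v) ∈ Q.edges) : Q.length ≤ 1 := by
  cases Q with
  | nil => simp
  | @cons _ w _ huw q =>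
    rw [Walk.cons_isPath_iff] at hQ
    rw [Walk.edges_cons, List.mem_cons] at h
    rcases h with h | h
    · have : v = w := by
        rw [Sym2.eq_iff] at h
        rcases h with h | h
        · exact h.2
        · exact h.2.trans h.1
      subst this
      have := Walk.isPath_iff_nil.1 hQ.1
      simp [Walk.length_eq_zero_iff.2 this]
    · exact absurd (q.fst_mem_support_of_mem_edges h) hQ.2

namespace SubdivisionModel

/-- The union of the paths of a model. -/
def unionSubgraph (R : Graph α β) (branch : α → V) (src tgt : R.edgeSet → α)
    (path : ∀ e : R.edgeSet, G.Walk (branch (src e)) (branch (tgt e))) : G.Subgraph where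
  verts := branch '' R.vertexSet ∪ {v | ∃ e, v ∈ (path e).support}
  Adj a b := ∃ e, s(a, b) ∈ (path e).edges
  adj_sub := fun ⟨e, h⟩ => (path e).adj_of_mem_edges h
  edge_vert := fun ⟨e, h⟩ => .inr ⟨e, (path e).fst_mem_support_of_mem_edges h⟩
  symm := ⟨fun a b ⟨e, h⟩ => ⟨e, by rwa [Sym2.eq_swap]⟩⟩

theorem edgeSet_unionSubgraph (branch : α → V) (src tgt : R.edgeSet → α)
    (path : ∀ e : R.edgeSet, G.Walk (branch (src e)) (branch (tgt e))) :
    (unionSubgraph R branch src tgt path).edgeSet = {d | ∃ e, d ∈ (path e).edges} := by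
  ext d
  induction d using Sym2.ind
  rfl

variable {F : G.Subgraph} (M : SubdivisionModel R F)

theorem support_subset (e : R.edgeSet) {v : V} (hv : v ∈ (M.path e).support) : v ∈ F.verts := by
  rw [M.verts_eq]
  exact .inr ⟨e, hv⟩

theorem branch_mem {x : α} (hx : x ∈ R.vertexSet) : M.branch x ∈ F.verts := by
  rw [M.verts_eq]
  exact .inl ⟨x, hx, rfl⟩

theorem mem_of_mem_interior (e : R.edgeSet) {v : V} (hv : v ∈ (M.path e).interior) :
    v ∈ F.verts := by
  refine M.support_subset e ?_
  rw [(M.path e).support_eq_interior (M.not_nil e)]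
  simp [hv]

/-- Replacing a segment of one of the paths by a detour through new vertices. -/
theorem exists_detour [Finite V] (e : R.edgeSet)
    {p : G.Walk (M.branch (M.src e)) (M.branch (M.tgt e))} (hp : M.path e = p) {i j : ℕ}
    (hij : i < j) (hj : j ≤ p.length) (Q : G.Walk (p.getVert i) (p.getVert j)) (hQ : Q.IsPath)
    (hQF : ∀ z ∈ Q.support, z ∈ F.verts → z = p.getVert i ∨ z = p.getVert j)
    (hQl : 2 ≤ Q.length) :
    ∃ F' : G.Subgraph, IsSubdivision R F' ∧
      F.verts.ncard + Q.length ≤ F'.verts.ncard + (j - i) := by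
  classical
  have hQn : ¬ Q.Nil := fun h => by
    have := Walk.length_eq_zero_iff.2 h
    omega
  have hpn : ¬ p.Nil := hp ▸ M.not_nil e
  have hpe : p.edges.Nodup := hp ▸ (M.isTrail e).edges_nodup
  have hpi : p.interior.Nodup := hp ▸ M.interior_nodup e
  have hpiF : ∀ z ∈ p.interior, z ∈ F.verts := fun z hz => M.mem_of_mem_interior e (hp ▸ hz)
  set p' := ((p.take i).append Q).append (p.drop j) with hp'
  have hint : p'.interior = p.interior.take i ++ Q.interior ++ p.interior.drop (j - 1) :=
    p.interior_append_append hpn hij hj Q hQn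
  have hQs := Q.support_eq_interior hQn
  have hQnd := hQ.support_nodup
  rw [hQs] at hQnd
  have hQi : ∀ z ∈ Q.interior, z ∉ F.verts := by
    intro z hz hzF
    rcases hQF z (by simp [hQs, hz]) hzF with h | h
    · exact (List.nodup_cons.1 hQnd).1 (List.mem_append_left _ (h ▸ hz))
    · exact List.disjoint_of_nodup_append hQnd.of_cons hz (by simp [h])
  -- An edge of `Q` inside `F.verts` would join the ends of `Q`, which a path of length at least two
  -- cannot contain. So all edges of `Q` are new.
  have hQe : ∀ d ∈ Q.edges, ∃ z ∈ d, z ∉ F.verts := by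
    intro d
    induction d using Sym2.ind with
    | _ a b =>
    intro hd
    by_contra hcon
    push Not at hcon
    have hab := (Q.adj_of_mem_edges hd).ne
    have h1 := hQF a (Q.fst_mem_support_of_mem_edges hd) (hcon a (by simp))
    have h2 := hQF b (Q.snd_mem_support_of_mem_edges hd) (hcon b (by simp))
    rcases h1 with rfl | rfl <;> rcases h2 with rfl | rfl
    · exact hab rfl
    · have := hQ.length_le_one hd
      omega
    · rw [Sym2.eq_swap] at hd
      have := hQ.length_le_one hd
      omega
    · exact hab rfl
  have hFe : ∀ e' : R.edgeSet, ∀ d ∈ (M.path e').edges, ∀ z ∈ d, z ∈ F.verts := fun e' d hd z hz =>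
    M.support_subset e' ((M.path e').mem_support_of_mem_edges hd hz)
  have hedges : p'.edges = p.edges.take i ++ Q.edges ++ p.edges.drop j := by
    rw [hp', Walk.edges_append, Walk.edges_append, Walk.edges_take, Walk.edges_drop]
  have hmemint : ∀ z ∈ p'.interior, z ∈ p.interior ∨ z ∈ Q.interior := by
    intro z hz
    rw [hint, List.mem_append, List.mem_append] at hz
    rcases hz with (h | h) | h
    exacts [.inl (List.mem_of_mem_take h), .inr h, .inl (List.mem_of_mem_drop h)]
  have hmemedge : ∀ d ∈ p'.edges, d ∈ p.edges ∨ d ∈ Q.edges := by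
    intro d hd
    rw [hedges, List.mem_append, List.mem_append] at hd
    rcases hd with (h | h) | h
    exacts [.inl (List.mem_of_mem_take h), .inr h, .inl (List.mem_of_mem_drop h)]
  let path' := Function.update M.path e p'
  have hself : path' e = p' := Function.update_self ..
  have hne : ∀ e', e' ≠ e → path' e' = M.path e' := fun e' h => Function.update_of_ne h ..
  have hindisj : ∀ e', e' ≠ e → List.Disjoint p'.interior (M.path e').interior := by
    intro e' he' z hz hz'
    rcases hmemint z hz with h | h
    · exact M.interior_disjoint e e' he'.symm (hp ▸ h) hz'
    · exact hQi z h (M.mem_of_mem_interior e' hz')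
  have hedisj : ∀ e', e' ≠ e → List.Disjoint p'.edges (M.path e').edges := by
    intro e' he' d hd hd'
    rcases hmemedge d hd with h | h
    · exact M.edges_disjoint e e' he'.symm (hp ▸ h) hd'
    · obtain ⟨z, hz, hzF⟩ := hQe d h
      exact hzF (hFe e' d hd' z hz)
  refine ⟨unionSubgraph R M.branch M.src M.tgt path', ⟨?_⟩, ?_⟩
  · refine
      { branch := M.branch
        src := M.src
        tgt := M.tgt
        path := path'
        branch_injOn := M.branch_injOn
        isLink := M.isLink
        not_nil := ?_
        isTrail := ?_
        interior_nodup := ?_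
        interior_new := ?_
        interior_disjoint := ?_
        edges_disjoint := ?_
        verts_eq := rfl
        edgeSet_eq := edgeSet_unionSubgraph .. }
    · intro e'
      by_cases he : e' = e
      · subst he
        rw [hself, hp', Walk.nil_append_iff, Walk.nil_append_iff]
        exact fun h => hQn h.1.2
      · rw [hne e' he]
        exact M.not_nil e'
    · intro e'
      by_cases he : e' = e
      · subst he
        rw [hself, Walk.isTrail_def, hedges]
        have hd : ∀ d ∈ p.edges, d ∉ Q.edges := by
          intro d hd hd'
          obtain ⟨z, hz, hzF⟩ := hQe d hd'
          exact hzF (hFe e' d (hp ▸ hd) z hz)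
        rw [List.nodup_append', List.nodup_append']
        refine ⟨⟨hpe.sublist (List.take_sublist _ _), hQ.isTrail.edges_nodup, ?_⟩,
          hpe.sublist (List.drop_sublist _ _), ?_⟩
        · exact fun d h h' => hd d (List.mem_of_mem_take h) h'
        · intro d h h'
          rcases List.mem_append.1 h with h | h
          · exact List.disjoint_take_drop hpe hij.le h h'
          · exact hd d (List.mem_of_mem_drop h') h
      · rw [hne e' he]
        exact M.isTrail e'
    · intro e'
      by_cases he : e' = e
      · subst he
        rw [hself, hint]
        have hd : ∀ d ∈ p.interior, d ∉ Q.interior := fun d hd hd' =>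
          hQi d hd' (hpiF d hd)
        rw [List.nodup_append', List.nodup_append']
        refine ⟨⟨hpi.sublist (List.take_sublist _ _), hQnd.of_cons.of_append_left, ?_⟩,
          hpi.sublist (List.drop_sublist _ _), ?_⟩
        · exact fun d h h' => hd d (List.mem_of_mem_take h) h'
        · intro d h h'
          rcases List.mem_append.1 h with h | h
          · exact List.disjoint_take_drop hpi (by omega) h h'
          · exact hd d (List.mem_of_mem_drop h') h
      · rw [hne e' he]
        exact M.interior_nodup e'
    · intro e' x hx hxi
      by_cases he : e' = e
      · subst he
        rw [hself] at hxi
        rcases hmemint _ hxi with h | h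
        · exact M.interior_new e' x hx (hp ▸ h)
        · exact hQi _ h (M.branch_mem hx)
      · rw [hne e' he] at hxi
        exact M.interior_new e' x hx hxi
    · intro e₁ e₂ h12
      by_cases h1 : e₁ = e
      · subst h1
        rw [hself, hne e₂ h12.symm]
        exact hindisj e₂ h12.symm
      · by_cases h2 : e₂ = e
        · subst h2
          rw [hself, hne e₁ h1]
          exact (hindisj e₁ h1).symm
        · rw [hne e₁ h1, hne e₂ h2]
          exact M.interior_disjoint e₁ e₂ h12
    · intro e₁ e₂ h12
      by_cases h1 : e₁ = e
      · subst h1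
        rw [hself, hne e₂ h12.symm]
        exact hedisj e₂ h12.symm
      · by_cases h2 : e₂ = e
        · subst h2
          rw [hself, hne e₁ h1]
          exact (hedisj e₁ h1).symm
        · rw [hne e₁ h1, hne e₂ h2]
          exact M.edges_disjoint e₁ e₂ h12
  -- `D` holds the vertices strictly between positions `i` and `j`. At most `j - i - 1` vertices are
  -- lost, and `Q.length - 1` are gained.
  · set D : Finset V := ((p.interior.take (j - 1)).drop i).toFinset with hD
    have hDc : D.card ≤ j - 1 - i := by
      refine (List.toFinset_card_le _).trans ?_
      rw [List.length_drop, List.length_take]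
      omega
    have hQc : (Q.interior.toFinset : Set V).ncard + 1 = Q.length := by
      rw [Set.ncard_coe_finset, List.toFinset_card_of_nodup hQnd.of_cons.of_append_left,
        Q.length_interior hQn]
    have hsub : (F.verts \ D) ∪ (Q.interior.toFinset : Set V) ⊆
        (unionSubgraph R M.branch M.src M.tgt path').verts := by
      have hs' : ∀ z, z ∈ p'.interior → z ∈ (unionSubgraph R M.branch M.src M.tgt path').verts := by
        intro z hz
        refine .inr ⟨e, ?_⟩
        rw [hself, Walk.support_eq_interior p' (fun h => by
          rw [hp', Walk.nil_append_iff, Walk.nil_append_iff] at h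
          exact hQn h.1.2)]
        simp [hz]
      rintro z (⟨hz, hzD⟩ | hz)
      · rw [M.verts_eq] at hz
        rcases hz with hz | ⟨e', hz⟩
        · exact .inl hz
        by_cases he : e' = e
        · subst he
          rw [hp, p.support_eq_interior hpn] at hz
          simp only [List.mem_cons, List.mem_append, List.not_mem_nil, or_false] at hz
          rcases hz with rfl | hz | rfl
          · exact .inl ⟨_, (M.isLink e').left_mem, rfl⟩
          · refine hs' z ?_
            have h1 : z ∈ p.interior.take (j - 1) ++ p.interior.drop (j - 1) := by
              rwa [List.take_append_drop]
            have h2 : p.interior.take i ++ (p.interior.take (j - 1)).drop i =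
                p.interior.take (j - 1) := by
              conv_rhs => rw [← List.take_append_drop i (p.interior.take (j - 1))]
              rw [List.take_take, min_eq_left (by omega)]
            rw [← h2] at h1
            rw [hD, List.coe_toFinset, Set.mem_ofPred_eq] at hzD
            rw [hint]
            simp only [List.mem_append] at h1 ⊢
            tauto
          · exact .inl ⟨_, (M.isLink e').right_mem, rfl⟩
        · refine .inr ⟨e', ?_⟩
          rwa [hne e' he]
      · refine hs' z ?_
        rw [List.coe_toFinset, Set.mem_ofPred_eq] at hz
        rw [hint]
        simp [hz]
    have h1 := Set.ncard_le_ncard hsub (Set.toFinite _)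
    rw [Set.ncard_union_eq (Set.disjoint_right.2 fun z hz hz' =>
      hQi z (by simpa using hz) hz'.1) (Set.toFinite _) (Set.toFinite _)] at h1
    have h2 := Set.le_ncard_sdiff (D : Set V) F.verts (Set.toFinite _)
    rw [Set.ncard_coe_finset] at h2
    omega

end SubdivisionModel

namespace SubdivisionModel

variable {F : G.Subgraph}

theorem branch_mem_support (M : SubdivisionModel R F) {e : R.edgeSet} {x y : α} (h : R.IsLink e x y) :
    M.branch x ∈ (M.path e).support := by
  rcases h.left_eq_or_eq (M.isLink e) with rfl | rfl
  exacts [Walk.start_mem_support _, Walk.end_mem_support _]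

/-- A connected `R` with an edge has no isolated vertex. -/
theorem verts_eq_support (M : SubdivisionModel R F) (hR : R.IsConnected)
    (hE : R.edgeSet.Nonempty) :
    F.verts = {v | ∃ e, v ∈ (M.path e).support} := by
  rw [M.verts_eq, Set.union_eq_right]
  rintro _ ⟨x, hx, rfl⟩
  obtain ⟨e, he⟩ := hE
  have hl := M.isLink ⟨e, he⟩
  rcases (hR.2 x hx _ hl.left_mem).cases_head with rfl | ⟨z, ⟨e', he'⟩, -⟩
  · exact ⟨_, M.branch_mem_support hl⟩
  · exact ⟨⟨e', he'.edge_mem⟩, M.branch_mem_support (e := ⟨e', he'.edge_mem⟩) he'⟩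

theorem joinedOff_of_mem_support (M : SubdivisionModel R F) {e : R.edgeSet} {x y : V}
    (hx : x ∈ (M.path e).support)
    (hy : y ∈ (M.path e).support) : G.JoinedOff F.vertsᶜ x y := by
  classical
  have h : ∀ v ∈ (M.path e).support, G.JoinedOff F.vertsᶜ (M.branch (M.src e)) v := fun v hv =>
    ⟨(M.path e).takeUntil v hv, fun z hz hzF =>
      hzF (M.support_subset e ((M.path e).support_takeUntil_subset_support hv hz))⟩
  exact (h x hx).symm.trans (h y hy)

theorem joinedOff (M : SubdivisionModel R F) (hR : R.IsConnected) (hE : R.edgeSet.Nonempty)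
    {x y : V} (hx : x ∈ F.verts) (hy : y ∈ F.verts) : G.JoinedOff F.vertsᶜ x y := by
  have hbranch : ∀ a b, Relation.ReflTransGen R.Adj a b → a ∈ R.vertexSet →
      G.JoinedOff F.vertsᶜ (M.branch a) (M.branch b) := by
    intro a b hab ha
    induction hab with
    | refl => exact .refl fun h => h (M.branch_mem ha)
    | tail _ h ih =>
      obtain ⟨e, he⟩ := h
      exact ih.trans (M.joinedOff_of_mem_support (e := ⟨e, he.edge_mem⟩)
        (M.branch_mem_support he) (M.branch_mem_support he.symm))
  rw [M.verts_eq_support hR hE] at hx hy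
  obtain ⟨e, hx⟩ := hx
  obtain ⟨e', hy⟩ := hy
  exact ((M.joinedOff_of_mem_support hx (Walk.start_mem_support _)).trans
    (hbranch _ _ (hR.2 _ (M.isLink e).left_mem _ (M.isLink e').left_mem)
      (M.isLink e).left_mem)).trans
    (M.joinedOff_of_mem_support (Walk.start_mem_support _) hy)

end SubdivisionModel

/-- A detour longer than the segment it replaces would give a subdivision with more vertices. -/
theorem IsMaxSubdivision.isRigid {α β V : Type*} [Finite V] {R : Graph α β} {G : SimpleGraph V}
    {F : G.Subgraph} (hF : IsMaxSubdivision R F) (hR : R.IsConnected)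
    (hE : 0 < R.edgeSet.ncard) : G.IsRigid R.edgeSet.ncard F.verts := by
  obtain ⟨⟨M⟩, hmax⟩ := hF
  have : Finite R.edgeSet := Set.finite_of_ncard_pos hE
  let φ : Fin R.edgeSet.ncard ≃ R.edgeSet :=
    (Finite.equivFinOfCardEq (Nat.card_coe_set_eq R.edgeSet)).symm
  refine ⟨fun i => M.branch (M.src (φ i)), fun i => M.branch (M.tgt (φ i)), fun i => M.path (φ i),
    ?_, fun i => M.not_nil _, fun i => M.interior_nodup _, ?_⟩
  · rw [M.verts_eq_support hR (Set.nonempty_of_ncard_ne_zero hE.ne')]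
    ext v
    exact ⟨fun ⟨e, he⟩ => ⟨φ.symm e, by
      change v ∈ (M.path (φ (φ.symm e))).support
      rwa [φ.apply_symm_apply]⟩, fun ⟨i, hi⟩ => ⟨_, hi⟩⟩
  · rintro i a b _ _ hab hb rfl rfl - Q hQ hQF
    by_contra hlt
    obtain ⟨F', hF', hle⟩ := M.exists_detour (φ i) rfl hab hb Q hQ hQF (by omega)
    have := hmax F' hF'
    omega

theorem isConnectedIntersecting_maxSubdivisions {α β V : Type*} {R : Graph α β}
    {G : SimpleGraph V} (hR : R.IsConnected) (hE : R.edgeSet.Nonempty)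
    (hG : ∀ F₁ F₂ : G.Subgraph, IsMaxSubdivision R F₁ → IsMaxSubdivision R F₂ →
      (F₁.verts ∩ F₂.verts).Nonempty) :
    G.IsConnectedIntersecting {U | ∃ F : G.Subgraph, IsMaxSubdivision R F ∧ F.verts = U} where
  inter := by
    rintro _ ⟨F, hF, rfl⟩ _ ⟨F', hF', rfl⟩
    exact hG F F' hF hF'
  conn := by
    rintro _ ⟨F, ⟨⟨M⟩, -⟩, rfl⟩ x hx y hy
    exact M.joinedOff hR hE hx hy

/-! ### Parameters and the numerical bound -/

/-- The value `√(m(n + 2)) + 1`, with the root rounded down, balances `d` against the number of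
blocks, about `mn / d`. -/
theorem exists_transversal_parameter (m n : ℕ) (hmn : m ≤ n) (hm : 1 ≤ m) :
    ∃ d, 0 < d ∧ m * ((n + 1) / d + 1) < 2 * d ∧ n < (d + 2) * d ∧
      (d - 1) * (d - 1) ≤ m * (n + 2) := by
  have h1 : m * (n + 2) < (Nat.sqrt (m * (n + 2)) + 1) * (Nat.sqrt (m * (n + 2)) + 1) :=
    Nat.lt_succ_sqrt _
  have h2 := Nat.sqrt_le (m * (n + 2))
  generalize Nat.sqrt (m * (n + 2)) = r at h1 h2
  have h3 : m * ((n + 1) / (r + 1)) < r + 1 := by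
    refine lt_of_mul_lt_mul_right (a := r + 1) ?_ (Nat.zero_le _)
    calc m * ((n + 1) / (r + 1)) * (r + 1) = m * ((n + 1) / (r + 1) * (r + 1)) := by ring
      _ ≤ m * (n + 2) := Nat.mul_le_mul_left _ ((Nat.div_mul_le_self _ _).trans (by omega))
      _ < _ := h1
  have h4 : m < r + 1 := by
    by_contra h
    have : (r + 1) * (r + 1) ≤ m * (n + 2) := Nat.mul_le_mul (by omega) (by omega)
    omega
  refine ⟨r + 1, by omega, ?_, ?_, by simpa using h2⟩
  · rw [mul_add]
    omega
  · nlinarith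

/-- With `a = m ^ (1/4)` and `b = n ^ (1/4)` the hypothesis gives `8 * a ^ 5 < b`. Since `d - 1 ≤ 2
* a ^ 2 * b ^ 2`, the left side is at most `21 * a ^ 6 * b ^ 2`, and one factor `a` is traded for `b
/ 8`. -/
theorem mul_le_rpow_of_lt {m n d : ℕ} (hm : 1 ≤ m)
    (h : 8 * (m : ℝ) ^ (5 / 4 : ℝ) * (n : ℝ) ^ (3 / 4 : ℝ) < n) :
    m ≤ n ∧ (0 < d → (d - 1) * (d - 1) ≤ m * (n + 2) →
      ((m * (6 * d + 3) : ℕ) : ℝ) ≤ 8 * (m : ℝ) ^ (5 / 4 : ℝ) * (n : ℝ) ^ (3 / 4 : ℝ)) := by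
  have hpow : ∀ (x k : ℕ), ((x : ℝ) ^ (1 / 4 : ℝ)) ^ k = (x : ℝ) ^ ((k : ℝ) / 4) := by
    intro x k
    rw [← Real.rpow_natCast, ← Real.rpow_mul (Nat.cast_nonneg x)]
    congr 1
    ring
  have ha5 := hpow m 5
  have ha4 := hpow m 4
  have hb3 := hpow n 3
  have hb4 := hpow n 4
  have ha1 : 1 ≤ (m : ℝ) ^ (1 / 4 : ℝ) := Real.one_le_rpow (by exact_mod_cast hm) (by norm_num)
  have hb0 : 0 ≤ (n : ℝ) ^ (1 / 4 : ℝ) := by positivity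
  norm_num at ha5 ha4 hb3 hb4 ha1 hb0
  rw [← ha5, ← hb3] at h ⊢
  generalize (m : ℝ) ^ (1 / 4 : ℝ) = a at *
  generalize (n : ℝ) ^ (1 / 4 : ℝ) = b at *
  have hab : 8 * a ^ 5 < b := by
    by_contra hle
    push Not at hle
    have := mul_le_mul_of_nonneg_right hle (pow_nonneg hb0 3)
    rw [← hb4] at h
    nlinarith
  have ha5' : a ≤ a ^ 5 := le_self_pow₀ ha1 (by norm_num)
  have hale : a ≤ b := by linarith
  have hb1 : 1 ≤ b := by linarith
  have hn1 : (1 : ℝ) ≤ n := by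
    rw [← hb4]
    exact one_le_pow₀ hb1
  refine ⟨?_, fun hd hdmn => ?_⟩
  · have : (m : ℝ) ≤ n := by
      rw [← ha4, ← hb4]
      gcongr
    exact_mod_cast this
  obtain ⟨e, rfl⟩ : ∃ e, d = e + 1 := ⟨d - 1, by omega⟩
  have he : (e : ℝ) * e ≤ m * (n + 2) := by
    rw [Nat.add_sub_cancel] at hdmn
    exact_mod_cast hdmn
  have he2 : (e : ℝ) ≤ 2 * (a ^ 2 * b ^ 2) := by
    refine abs_le_of_sq_le_sq' ?_ (by positivity) |>.2
    have : (m : ℝ) * (n + 2) ≤ m * (4 * n) := by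
      gcongr
      linarith
    calc (e : ℝ) ^ 2 ≤ m * (4 * n) := by nlinarith
      _ = (2 * (a ^ 2 * b ^ 2)) ^ 2 := by rw [← ha4, ← hb4]; ring
  push_cast
  have h1 : 1 ≤ a ^ 2 * b ^ 2 := one_le_mul_of_one_le_of_one_le (one_le_pow₀ ha1) (one_le_pow₀ hb1)
  calc (m : ℝ) * (6 * (e + 1) + 3) ≤ m * (21 * (a ^ 2 * b ^ 2)) := by
        gcongr
        linarith
    _ = 21 * (a ^ 5 * b ^ 2 * a) := by rw [← ha4]; ring
    _ ≤ 21 * (a ^ 5 * b ^ 2 * (b / 8)) := by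
        gcongr
        linarith
    _ ≤ 8 * a ^ 5 * b ^ 3 := by
        have : 0 ≤ a ^ 5 * b ^ 3 := by positivity
        linarith

end Subdivisions

theorem theorem1 {α β V : Type*} [Fintype V] (R : Graph α β) (m : ℕ) (hm : 1 ≤ m)
    (hRm : R.edgeSet.ncard = m) (hR : R.IsConnected) (G : SimpleGraph V) (n : ℕ)
    (hn : Fintype.card V = n)
    (hG : ∀ F₁ F₂ : G.Subgraph, IsMaxSubdivision R F₁ → IsMaxSubdivision R F₂ →
      (F₁.verts ∩ F₂.verts).Nonempty) :
    ∃ S : Finset V, IsSubdivisionTransversal R G S ∧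
      (S.card : ℝ) ≤ 8 * (m : ℝ) ^ (5 / 4 : ℝ) * (n : ℝ) ^ (3 / 4 : ℝ) := by
  -- If the bound is at least `n`, all vertices may be taken.
  rcases le_or_gt (n : ℝ) (8 * (m : ℝ) ^ (5 / 4 : ℝ) * (n : ℝ) ^ (3 / 4 : ℝ)) with h | h
  · refine ⟨Finset.univ, fun F hF => ?_, by rwa [Finset.card_univ, hn]⟩
    obtain ⟨⟨M⟩, -⟩ := hF
    obtain ⟨x, hx⟩ := hR.1
    exact ⟨M.branch x, Finset.mem_univ _, M.branch_mem hx⟩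
  have hE : 0 < R.edgeSet.ncard := by omega
  obtain ⟨d, hd, hmd, hnd, hdd⟩ :=
    exists_transversal_parameter m n (mul_le_rpow_of_lt (d := 0) hm h).1 hm
  subst hn
  obtain ⟨T, hT, hTF⟩ := (isConnectedIntersecting_maxSubdivisions hR
      (Set.nonempty_of_ncard_ne_zero hE.ne') hG).exists_transversal (m := m) (d := d) (l := d)
    (N := m * (6 * d + 3) + 1) (by
      rintro _ ⟨F, hF, rfl⟩
      exact hRm ▸ hF.isRigid hR hE) hd hmd hd hnd (by nlinarith) (by nlinarith) le_rfl
  refine ⟨T, fun F hF => hTF _ ⟨F, hF, rfl⟩, le_trans ?_ ((mul_le_rpow_of_lt hm h).2 hd hdd)⟩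
  exact_mod_cast Nat.le_of_lt_succ hT
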